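/- Let $K$ be an algebraically closed field, $m\ge 2$ an integer and $\lambda\in K\setminus\{0\}$. Let $S=S(m,\lambda)$ be the higher spherical algebra: the quotient of the path algebra over $K$ (paths composed from left to right) of the quiver with vertices $1,\dots,6$ and arrows $$\alpha:1\to2,\quad \beta:2\to3,\quad \gamma:3\to4,\quad \sigma:4\to1,\quad \rho:1\to6,\quad \omega:6\to3,\quad \nu:3\to5,\quad \delta:5\to1$$ by the two-sided ideal generated by the relations $$\beta\nu\delta=\beta\gamma\sigma+\lambda(\beta\gamma\sigma\alpha)^{m-1}\beta\gamma\sigma,\qquad \nu\delta\alpha=\gamma\sigma\alpha+\lambda(\gamma\sigma\alpha\beta)^{m-1}\gamma\sigma\alpha,$$ $$\sigma\rho\omega=\sigma\alpha\beta+\lambda(\sigma\alpha\beta\gamma)^{m-1}\sigma\alpha\beta,\qquad \rho\omega\gamma=\alpha\beta\gamma+\lambda(\alpha\beta\gamma\sigma)^{m-1}\alpha\beta\gamma,$$ $$\alpha\beta\nu=\rho\omega\nu,\quad \delta\alpha\beta=\delta\rho\omega,\quad \omega\gamma\sigma=\omega\nu\delta,\quad \gamma\sigma\rho=\nu\delta\rho,\quad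 (\alpha\beta\gamma\sigma)^m\alpha=0,\quad (\gamma\sigma\alpha\beta)^m\gamma=0.$$ Let $e_i$ be the idempotent of $S$ at the vertex $i$, and let $P_i=e_iS$, a projective right $S$-module, regarded also as a stalk complex in degree $0$. Let $\bar P_4$ and $\bar P_5$ be the two-term complexes $P_4\xrightarrow{\gamma}P_3$ and $P_5\xrightarrow{\nu}P_3$, whose maps are left multiplication by $\gamma$ and by $\nu$, with $P_3$ in degree $0$ and $P_4$, $P_5$ in homological degree $1$. Let $K^b(\mathrm{proj}\,S)$ be the homotopy category of bounded complexes of finitely generated projective right $S$-modules, regarded as a strictly full triangulated subcategory of the homotopy category of complexes of right $S$-modules. Then $$T^{(1)}=P_1\oplus P_2\oplus P_3\oplus P_4\oplus\bar P_5\oplus P_6\qquad\text{and}\qquad T^{(2)}=P_1\oplus P_2\oplus P_3\oplus\bar P_4\oplus\bar P_5\oplus P_6$$ are tilting complexes in $K^b(\mathrm{proj}\,S)$. That is, for each $T\in\{T^{(1)},T^{(2)}\}$, the complex $T$ belongs to $K^b(\mathrm{proj}\,S)$; one has $\mathrm{Hom}(T,T[i])=0$ in $K^b(\mathrm{proj}\,S)$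 for every integer $i\ne0$; and $\mathrm{add}(T)$, the class of direct summands of finite direct sums of copies of $T$, generates $K^b(\mathrm{proj}\,S)$ as a triangulated category, i.e. every strictly full triangulated subcategory containing $\mathrm{add}(T)$ contains $K^b(\mathrm{proj}\,S)$. -/

import Mathlib

open CategoryTheory CategoryTheory.Limits

universe u

/-! ### Tilting complexes over a ring

Right modules over `A` are modules over `Aᵐᵒᵖ`. Complexes are graded cohomologically, so that a term
of homological degree `n` sits in degree `-n`. -/

namespace Tilting

/-- The homotopy category `K(Mod A)` of complexes of right `A`-modules. -/
abbrev HoMod (A : Type u) [Ring A] : Type (u + 1) :=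
  HomotopyCategory (ModuleCat.{u} Aᵐᵒᵖ) (ComplexShape.up ℤ)

/-- A bounded complex whose terms are finitely generated projective right `A`-modules. -/
structure IsPerfectComplex (A : Type u) [Ring A] (X : CochainComplex (ModuleCat.{u} Aᵐᵒᵖ) ℤ) :
    Prop where
  bounded : ∃ a b : ℤ, ∀ n : ℤ, n < a ∨ b < n → IsZero (X.X n)
  finite : ∀ n : ℤ, Module.Finite Aᵐᵒᵖ (X.X n)
  projective : ∀ n : ℤ, Module.Projective Aᵐᵒᵖ (X.X n)

/-- The (strictly full) subcategory `K^b(proj A)` of the homotopy category `K(Mod A)`. -/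
def kbProj (A : Type u) [Ring A] : ObjectProperty (HoMod A) := fun Y =>
  ∃ X : CochainComplex (ModuleCat.{u} Aᵐᵒᵖ) ℤ, IsPerfectComplex A X ∧
    Nonempty (Y ≅ (HomotopyCategory.quotient _ _).obj X)

/-- `add(T)`: the direct summands of finite direct sums of copies of `T`. -/
def addOf (A : Type u) [Ring A] (T : HoMod A) : ObjectProperty (HoMod A) := fun Y =>
  ∃ n : ℕ, Nonempty (Retract Y (⨁ fun _ : Fin n => T))

/-- `T` is a tilting complex in `K^b(proj A)`: it is an object of `K^b(proj A)`, it has no nonzero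
morphism to a nonzero shift of itself, and every strictly full triangulated subcategory which
contains `add(T)` contains `K^b(proj A)`. -/
structure IsTiltingComplex (A : Type u) [Ring A] (T : HoMod A) : Prop where
  mem : kbProj A T
  hom_shift_eq_zero : ∀ i : ℤ, i ≠ 0 → ∀ f : T ⟶ (shiftFunctor (HoMod A) i).obj T, f = 0
  generates : ∀ Q : ObjectProperty (HoMod A), Q.IsTriangulated → Q.IsClosedUnderIsomorphisms →
    addOf A T ≤ Q → kbProj A ≤ Q

end Tilting

/-! ### Higher spherical algebras -/

namespace HigherSpherical

/-- The vertices of the quiver. -/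
inductive Vertex : Type
  | v1 | v2 | v3 | v4 | v5 | v6
  deriving DecidableEq

instance : Fintype Vertex where
  elems := {.v1, .v2, .v3, .v4, .v5, .v6}
  complete i := by cases i <;> decide

/-- The arrows of the quiver. -/
inductive Arrow : Type
  | α | β | γ | σ | ρ | ω | ν | δ

namespace Arrow

/-- The source of an arrow. -/
def src : Arrow → Vertex
  | α => .v1
  | β => .v2
  | γ => .v3
  | σ => .v4
  | ρ => .v1
  | ω => .v6
  | ν => .v3
  | δ => .v5

/-- The target of an arrow. -/
def tgt : Arrow → Vertex
  | α => .v2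
  | β => .v3
  | γ => .v4
  | σ => .v1
  | ρ => .v6
  | ω => .v3
  | ν => .v5
  | δ => .v1

end Arrow

/-- The free algebra on the trivial paths and the arrows. -/
abbrev FreeAlg (K : Type u) [Field K] : Type u := FreeAlgebra K (Vertex ⊕ Arrow)

/-- The generator given by the trivial path at a vertex. -/
def vtx (K : Type u) [Field K] (i : Vertex) : FreeAlg K := FreeAlgebra.ι K (Sum.inl i)

/-- The generator given by an arrow. -/
def arr (K : Type u) [Field K] (a : Arrow) : FreeAlg K := FreeAlgebra.ι K (Sum.inr a)

open Arrow in
/-- The defining relations of the higher spherical algebra. The first four constructors present the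
path algebra of the quiver (the trivial paths are orthogonal idempotents with sum `1`, and an arrow
`a` from `i` to `j` satisfies `eᵢ a = a = a eⱼ`; paths are composed from left to right), and the
other ten are the relations imposed on the path algebra. -/
inductive Rel (K : Type u) [Field K] (m : ℕ) (lam : K) : FreeAlg K → FreeAlg K → Prop
  | vtx_mul_vtx (i j : Vertex) : Rel K m lam (vtx K i * vtx K j) (if i = j then vtx K i else 0)
  | sum_vtx : Rel K m lam (∑ i : Vertex, vtx K i) 1
  | src_mul (a : Arrow) : Rel K m lam (vtx K a.src * arr K a) (arr K a)
  | mul_tgt (a : Arrow) : Rel K m lam (arr K a * vtx K a.tgt) (arr K a)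
  | r1 : Rel K m lam (arr K β * arr K ν * arr K δ)
      (arr K β * arr K γ * arr K σ +
        lam • ((arr K β * arr K γ * arr K σ * arr K α) ^ (m - 1) * (arr K β * arr K γ * arr K σ)))
  | r2 : Rel K m lam (arr K ν * arr K δ * arr K α)
      (arr K γ * arr K σ * arr K α +
        lam • ((arr K γ * arr K σ * arr K α * arr K β) ^ (m - 1) * (arr K γ * arr K σ * arr K α)))
  | r3 : Rel K m lam (arr K σ * arr K ρ * arr K ω)
      (arr K σ * arr K α * arr K β +
        lam • ((arr K σ * arr K α * arr K β * arr K γ) ^ (m - 1) * (arr K σ * arr K α * arr K β)))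
  | r4 : Rel K m lam (arr K ρ * arr K ω * arr K γ)
      (arr K α * arr K β * arr K γ +
        lam • ((arr K α * arr K β * arr K γ * arr K σ) ^ (m - 1) * (arr K α * arr K β * arr K γ)))
  | r5 : Rel K m lam (arr K α * arr K β * arr K ν) (arr K ρ * arr K ω * arr K ν)
  | r6 : Rel K m lam (arr K δ * arr K α * arr K β) (arr K δ * arr K ρ * arr K ω)
  | r7 : Rel K m lam (arr K ω * arr K γ * arr K σ) (arr K ω * arr K ν * arr K δ)
  | r8 : Rel K m lam (arr K γ * arr K σ * arr K ρ) (arr K ν * arr K δ * arr K ρ)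
  | r9 : Rel K m lam ((arr K α * arr K β * arr K γ * arr K σ) ^ m * arr K α) 0
  | r10 : Rel K m lam ((arr K γ * arr K σ * arr K α * arr K β) ^ m * arr K γ) 0

/-- The higher spherical algebra `S(m, lam)`. -/
abbrev S (K : Type u) [Field K] (m : ℕ) (lam : K) : Type u := RingQuot (Rel K m lam)

section

variable (K : Type u) [Field K] (m : ℕ) (lam : K)

/-- The idempotent `eᵢ` of `S(m, lam)`. -/
noncomputable def e (i : Vertex) : S K m lam := RingQuot.mkAlgHom K (Rel K m lam) (vtx K i)

/-- The class of an arrow in `S(m, lam)`. -/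
noncomputable def arrow (a : Arrow) : S K m lam := RingQuot.mkAlgHom K (Rel K m lam) (arr K a)

/-- Left multiplication by `x`, as an endomorphism of the right module `S(m, lam)`. -/
def leftMul (x : S K m lam) : S K m lam →ₗ[(S K m lam)ᵐᵒᵖ] S K m lam where
  toFun y := x * y
  map_add' := mul_add x
  map_smul' r y := (mul_assoc x y r.unop).symm

/-- The right ideal `eᵢ S` of `S = S(m, lam)`. -/
noncomputable def idealP (i : Vertex) : Submodule (S K m lam)ᵐᵒᵖ (S K m lam) :=
  LinearMap.range (leftMul K m lam (e K m lam i))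

lemma e_src_mul_arrow (a : Arrow) : e K m lam a.src * arrow K m lam a = arrow K m lam a := by
  rw [e, arrow, ← map_mul]
  exact RingQuot.mkAlgHom_rel K (Rel.src_mul a)

lemma leftMul_arrow_mem (a : Arrow) (x : S K m lam) :
    leftMul K m lam (arrow K m lam a) x ∈ idealP K m lam a.src :=
  ⟨arrow K m lam a * x, by
    change e K m lam a.src * (arrow K m lam a * x) = arrow K m lam a * x
    rw [← mul_assoc, e_src_mul_arrow]⟩

/-- The projective right module `Pᵢ = eᵢ S`. -/
noncomputable def P (i : Vertex) : ModuleCat.{u} (S K m lam)ᵐᵒᵖ :=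
  ModuleCat.of (S K m lam)ᵐᵒᵖ (idealP K m lam i)

/-- The homomorphism `Pⱼ → Pᵢ` given by left multiplication by an arrow from `i` to `j`. -/
noncomputable def arrowHom (a : Arrow) : P K m lam a.tgt ⟶ P K m lam a.src :=
  ModuleCat.ofHom ((leftMul K m lam (arrow K m lam a)).restrict
    (p := idealP K m lam a.tgt) (q := idealP K m lam a.src)
    fun x _ => leftMul_arrow_mem K m lam a x)

/-- The stalk complex of `Pᵢ`, concentrated in degree `0`. -/
noncomputable def stalk (i : Vertex) : CochainComplex (ModuleCat.{u} (S K m lam)ᵐᵒᵖ) ℤ :=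
  (CochainComplex.singleFunctor (ModuleCat.{u} (S K m lam)ᵐᵒᵖ) 0).obj (P K m lam i)

/-- The two-term complex `Pⱼ → Pᵢ` given by an arrow from `i` to `j`, where `Pᵢ` has degree `0` and
`Pⱼ` has homological degree `1`, that is, cohomological degree `-1`. -/
noncomputable def twoTerm (a : Arrow) : CochainComplex (ModuleCat.{u} (S K m lam)ᵐᵒᵖ) ℤ :=
  HomologicalComplex.double (arrowHom K m lam a)
    (show (ComplexShape.up ℤ).Rel (-1) 0 from neg_add_cancel 1)

/-- The summands `P₁, P₂, P₃, P₄, P̄₅, P₆` of the first complex. -/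
noncomputable def summand₁ : Vertex → CochainComplex (ModuleCat.{u} (S K m lam)ᵐᵒᵖ) ℤ
  | .v1 => stalk K m lam .v1
  | .v2 => stalk K m lam .v2
  | .v3 => stalk K m lam .v3
  | .v4 => stalk K m lam .v4
  | .v5 => twoTerm K m lam .ν
  | .v6 => stalk K m lam .v6

/-- The summands `P₁, P₂, P₃, P̄₄, P̄₅, P₆` of the second complex. -/
noncomputable def summand₂ : Vertex → CochainComplex (ModuleCat.{u} (S K m lam)ᵐᵒᵖ) ℤ
  | .v1 => stalk K m lam .v1
  | .v2 => stalk K m lam .v2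
  | .v3 => stalk K m lam .v3
  | .v4 => twoTerm K m lam .γ
  | .v5 => twoTerm K m lam .ν
  | .v6 => stalk K m lam .v6

/-- The complex `T⁽¹⁾ = P₁ ⊕ P₂ ⊕ P₃ ⊕ P₄ ⊕ P̄₅ ⊕ P₆` in the homotopy category. -/
noncomputable def T₁ : Tilting.HoMod (S K m lam) :=
  ⨁ fun i : Vertex => (HomotopyCategory.quotient _ _).obj (summand₁ K m lam i)

/-- The complex `T⁽²⁾ = P₁ ⊕ P₂ ⊕ P₃ ⊕ P̄₄ ⊕ P̄₅ ⊕ P₆` in the homotopy category. -/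
noncomputable def T₂ : Tilting.HoMod (S K m lam) :=
  ⨁ fun i : Vertex => (HomotopyCategory.quotient _ _).obj (summand₂ K m lam i)

end

end HigherSpherical

namespace HigherSpherical

/-! Every summand of either complex has the form X⁻¹ → X⁰ with X⁰ = P_b, where b ≠ 5, and for T⁽²⁾
also b ≠ 4. For degree reasons a morphism X → Y[n] with n ≠ 0 can be nonzero only for n = 1 or n =
-1.

For n = 1 it is a map X⁻¹ → Y⁰, and it is null-homotopic as soon as it factors through X⁻¹ → X⁰.
Since Hom(P_i, P_j) = e_jSe_i, this amounts to e_jSe₅ ⊆ e_jSν for j ≠ 5 and e_jSe₄ ⊆ e_jSγ for j ≠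
4, which holds because ν and γ are the only arrows that end at 5 and at 4.

For n = -1 it is a map X⁰ → Y⁻¹ killed by the differential of Y. It vanishes if left multiplication
by ν is injective on e₅Se_i for i ≠ 5, and left multiplication by γ on e₄Se_i for i ≠ 4, 5
(`eq_zero_of_nu_mul`, `eq_zero_of_gamma_mul`). This is the heart of the proof. Put C = αβγσ.
Rewriting with the relations shows that e₁S is spanned by the products of a power of C and one of
seven short paths (`e1_mul_mem_cycSpan`). Hence e₅Se_i and e₄Se_i are spanned by the elements δCʲw
and σCʲw for one short path w; for i = 3 the two candidates αβ and ρω merge after multiplication by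
δ or σ. Because λ ≠ 0, the relations force σCᵐ = 0, δCᵐ = 0 and δCᵐ⁻¹αβγ = 0, so only finitely many
j remain. For these j the elements νδCʲw, respectively γσCʲw, are linearly independent: they are
tested on one vector of an explicit right module modelled on e₃S (`repHom`,
`mul_aeval_mul_eq_zero`).

Generation has three ingredients. The triangle P₃ → P̄ → P[1] recovers P₄ and P₅ from the two-term
complexes. The arrows generate a nilpotent ideal with quotient K⁶, so every finitely generated
projective is a finite sum of modules P_i (`exists_equiv_pi_P`). A bounded complex of projectives is
assembled from its terms by degreewise split extensions (`kbProj_le`). -/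

instance : DecidableEq Arrow := fun a b =>
  decidable_of_iff (a.src = b.src ∧ a.tgt = b.tgt)
    ⟨fun h => by cases a <;> cases b <;> simp_all [Arrow.src, Arrow.tgt], by rintro rfl; simp⟩

instance : Fintype Arrow where
  elems := {.α, .β, .γ, .σ, .ρ, .ω, .ν, .δ}
  complete a := by cases a <;> decide

/-! ### Consequences of the relations for the cycle C = αβγσ -/

section Relations

variable {K : Type u} [Field K] {m : ℕ} {lam : K}

local notation "E1" => e K m lam Vertex.v1
local notation "A1" => arrow K m lam Arrow.α
local notation "B1" => arrow K m lam Arrow.β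
local notation "G1" => arrow K m lam Arrow.γ
local notation "S1" => arrow K m lam Arrow.σ
local notation "R1" => arrow K m lam Arrow.ρ
local notation "O1" => arrow K m lam Arrow.ω
local notation "N1" => arrow K m lam Arrow.ν
local notation "D1" => arrow K m lam Arrow.δ

lemma e_mul_e (i j : Vertex) :
    e K m lam i * e K m lam j = if i = j then e K m lam i else 0 := by
  have h := RingQuot.mkAlgHom_rel K (Rel.vtx_mul_vtx (K := K) (m := m) (lam := lam) i j)
  rw [map_mul] at h
  rw [e, e, h]
  split_ifs <;> simp

lemma sum_e : ∑ i : Vertex, e K m lam i = 1 := by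
  have h := RingQuot.mkAlgHom_rel K (Rel.sum_vtx (K := K) (m := m) (lam := lam))
  rwa [map_sum, map_one] at h

lemma sum_vertex {M : Type*} [AddCommMonoid M] (f : Vertex → M) :
    ∑ i, f i = f .v1 + f .v2 + f .v3 + f .v4 + f .v5 + f .v6 := by
  have h : (Finset.univ : Finset Vertex) = {.v1, .v2, .v3, .v4, .v5, .v6} := rfl
  rw [h]
  simp [add_assoc]

lemma sum_arrow {M : Type*} [AddCommMonoid M] (f : Arrow → M) :
    ∑ a, f a = f .α + f .β + f .γ + f .σ + f .ρ + f .ω + f .ν + f .δ := by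
  have h : (Finset.univ : Finset Arrow) = {.α, .β, .γ, .σ, .ρ, .ω, .ν, .δ} := by
    ext a; cases a <;> simp
  rw [h]
  simp [add_assoc]

lemma arrow_mul_e_tgt (a : Arrow) :
    arrow K m lam a * e K m lam a.tgt = arrow K m lam a := by
  rw [e, arrow, ← map_mul]
  exact RingQuot.mkAlgHom_rel K (Rel.mul_tgt a)

lemma e_mul_arrow (i : Vertex) (a : Arrow) :
    e K m lam i * arrow K m lam a = if i = a.src then arrow K m lam a else 0 := by
  rw [← e_src_mul_arrow, ← mul_assoc, e_mul_e]
  split_ifs with h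
  · rw [h]
  · rw [zero_mul]

lemma arrow_mul_e (i : Vertex) (a : Arrow) :
    arrow K m lam a * e K m lam i = if a.tgt = i then arrow K m lam a else 0 := by
  rw [← arrow_mul_e_tgt, mul_assoc, e_mul_e]
  split_ifs with h
  · rfl
  · rw [mul_zero]

lemma arrow_mul_arrow_of_ne {a b : Arrow} (h : a.tgt ≠ b.src) :
    arrow K m lam a * arrow K m lam b = 0 := by
  rw [← arrow_mul_e_tgt, mul_assoc, e_mul_arrow, if_neg h, mul_zero]

variable (K m lam) in
/-- The cycle `αβγσ` at the vertex `1`. -/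
noncomputable def cyc : S K m lam := A1 * B1 * G1 * S1

local notation "C1" => cyc K m lam

lemma cyc_mul_e1 : C1 * E1 = C1 := by
  simp only [cyc, mul_assoc, arrow_mul_e]; simp [Arrow.tgt]

lemma rel1 : B1 * N1 * D1 =
    B1 * G1 * S1 + lam • ((B1 * G1 * S1 * A1) ^ (m - 1) * (B1 * G1 * S1)) := by
  simpa [arrow] using RingQuot.mkAlgHom_rel K (Rel.r1 (K := K) (m := m) (lam := lam))

lemma rel3 : S1 * R1 * O1 =
    S1 * A1 * B1 + lam • ((S1 * A1 * B1 * G1) ^ (m - 1) * (S1 * A1 * B1)) := by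
  simpa [arrow] using RingQuot.mkAlgHom_rel K (Rel.r3 (K := K) (m := m) (lam := lam))

lemma rel4 : R1 * O1 * G1 =
    A1 * B1 * G1 + lam • (C1 ^ (m - 1) * (A1 * B1 * G1)) := by
  simpa [arrow, cyc] using RingQuot.mkAlgHom_rel K (Rel.r4 (K := K) (m := m) (lam := lam))

lemma rel5 : A1 * B1 * N1 = R1 * O1 * N1 := by
  simpa [arrow] using RingQuot.mkAlgHom_rel K (Rel.r5 (K := K) (m := m) (lam := lam))

lemma rel6 : D1 * A1 * B1 = D1 * R1 * O1 := by
  simpa [arrow] using RingQuot.mkAlgHom_rel K (Rel.r6 (K := K) (m := m) (lam := lam))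

lemma rel7 : O1 * G1 * S1 = O1 * N1 * D1 := by
  simpa [arrow] using RingQuot.mkAlgHom_rel K (Rel.r7 (K := K) (m := m) (lam := lam))

lemma cyc_pow_mul_alpha : C1 ^ m * A1 = 0 := by
  simpa [arrow, cyc] using RingQuot.mkAlgHom_rel K (Rel.r9 (K := K) (m := m) (lam := lam))

/-- Multiply `rel1` by α on the left and slide α through the power: α(βγσα)ᵏ = (αβγσ)ᵏα. -/
lemma alpha_beta_nu_delta (hm : 2 ≤ m) : A1 * B1 * N1 * D1 = C1 + lam • C1 ^ m := by
  have h : A1 * (B1 * G1 * S1 * A1) ^ (m - 1) = C1 ^ (m - 1) * A1 := by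
    rw [cyc, show A1 * B1 * G1 * S1 = A1 * (B1 * G1 * S1) by simp only [mul_assoc], mul_pow_mul]
  have h2 : C1 ^ m = C1 ^ (m - 1) * C1 := by rw [← pow_succ]; congr 1; omega
  calc A1 * B1 * N1 * D1 = A1 * (B1 * N1 * D1) := by simp only [mul_assoc]
    _ = A1 * (B1 * G1 * S1) + lam • (A1 * (B1 * G1 * S1 * A1) ^ (m - 1) * (B1 * G1 * S1)) := by
      rw [rel1, mul_add, mul_smul_comm, mul_assoc A1 (_ ^ _)]
    _ = C1 + lam • C1 ^ m := by
      rw [h, h2]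
      simp only [cyc, mul_assoc]

lemma cyc_pow_succ : C1 ^ (m + 1) = 0 := by
  rw [pow_succ]
  nth_rw 2 [cyc]
  rw [← mul_assoc, ← mul_assoc, ← mul_assoc, cyc_pow_mul_alpha]
  simp only [zero_mul]

lemma cyc_pow_eq_zero {k : ℕ} (hk : m + 1 ≤ k) : C1 ^ k = 0 :=
  pow_eq_zero_of_le hk cyc_pow_succ

/-- With its two neighbours this shows that all four closed walks of length four at the vertex 1 are
polynomials in C, which drives both the spanning statement and the nilpotency of the arrow ideal. -/
lemma rho_omega_nu_delta (hm : 2 ≤ m) : R1 * O1 * N1 * D1 = C1 + lam • C1 ^ m := by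
  rw [← rel5, alpha_beta_nu_delta hm]

lemma rho_omega_gamma_sigma (hm : 2 ≤ m) : R1 * O1 * G1 * S1 = C1 + lam • C1 ^ m := by
  rw [mul_assoc R1, mul_assoc, rel7, ← rho_omega_nu_delta hm]
  simp only [mul_assoc]

lemma sigma_rho_omega : S1 * (R1 * O1) =
    S1 * (A1 * B1) + lam • (S1 * C1 ^ (m - 1) * (A1 * B1)) := by
  have h : S1 * C1 ^ (m - 1) = (S1 * A1 * B1 * G1) ^ (m - 1) * S1 := by
    rw [cyc, show S1 * A1 * B1 * G1 = S1 * (A1 * B1 * G1) by simp only [mul_assoc], mul_pow_mul]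
  rw [h, ← mul_assoc, rel3]
  simp only [mul_assoc]

/-- Evaluate σρωνδ in two ways. By `rel5` it is σαβνδ, while `rel3` adds the term λσCᵐ⁻¹αβνδ, which
therefore vanishes. Here αβνδ = C + λCᵐ, and Cᵐ⁻¹Cᵐ = 0 since 2m - 1 ≥ m + 1, so what survives is
σCᵐ. -/
lemma sigma_mul_cyc_pow (hm : 2 ≤ m) (hlam : lam ≠ 0) : S1 * C1 ^ m = 0 := by
  have h1 : S1 * (R1 * O1 * N1 * D1) = S1 * (A1 * B1 * N1 * D1) := by rw [rel5]
  have h2 : S1 * (R1 * O1 * N1 * D1) = S1 * (A1 * B1 * N1 * D1) +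
      lam • (S1 * C1 ^ (m - 1) * (A1 * B1 * N1 * D1)) := by
    calc _ = S1 * (R1 * O1) * (N1 * D1) := by simp only [mul_assoc]
      _ = _ := by
        rw [sigma_rho_omega, add_mul, smul_mul_assoc]
        simp only [mul_assoc]
  rw [h1, left_eq_add, smul_eq_zero, alpha_beta_nu_delta hm] at h2
  have h3 := h2.resolve_left hlam
  have h4 : C1 ^ m = C1 ^ (m - 1) * C1 := by rw [← pow_succ]; congr 1; omega
  rw [mul_add, mul_smul_comm, mul_assoc, mul_assoc, ← pow_succ, ← pow_add,
    cyc_pow_eq_zero (k := m - 1 + m) (by omega), mul_zero, smul_zero, add_zero] at h3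
  rwa [Nat.sub_add_cancel (by omega : 1 ≤ m)] at h3

/-- Evaluate δρωγ in two ways: `rel6` gives δαβγ, and `rel4` gives the same plus λδCᵐ⁻¹αβγ. -/
lemma delta_mul_cyc_pow_pred (hlam : lam ≠ 0) :
    D1 * C1 ^ (m - 1) * (A1 * B1 * G1) = 0 := by
  have h : D1 * (R1 * O1 * G1) = D1 * (A1 * B1 * G1) := by
    simp only [← mul_assoc]
    rw [rel6]
  rw [rel4, mul_add, add_eq_left, mul_smul_comm, smul_eq_zero] at h
  rw [mul_assoc]
  exact h.resolve_left hlam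

lemma delta_mul_cyc_pow (hm : 2 ≤ m) (hlam : lam ≠ 0) : D1 * C1 ^ m = 0 := by
  have h4 : C1 ^ m = C1 ^ (m - 1) * C1 := by rw [← pow_succ]; congr 1; omega
  rw [h4, ← mul_assoc]
  nth_rw 2 [cyc]
  rw [← mul_assoc, delta_mul_cyc_pow_pred hlam, zero_mul]

/-- The factor σ at the end of C turns ρω into αβ up to a correction, and the correction contains
Cᵐα = 0. -/
lemma cyc_mul_rho_omega (hm : 2 ≤ m) : C1 * (R1 * O1) = C1 * (A1 * B1) := by
  have h4 : C1 ^ m = C1 * C1 ^ (m - 1) := by rw [← pow_succ']; congr 1; omega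
  calc C1 * (R1 * O1) = A1 * B1 * G1 * (S1 * (R1 * O1)) := by simp only [cyc, mul_assoc]
    _ = C1 * (A1 * B1) + lam • (C1 ^ m * A1 * B1) := by
      rw [sigma_rho_omega, mul_add, mul_smul_comm, h4]
      simp only [mul_assoc, cyc]
    _ = _ := by rw [cyc_pow_mul_alpha, zero_mul, smul_zero, add_zero]

end Relations

/-! ### Generators, and expansion of an element by first or last arrow -/

section Structure

variable {K : Type u} [Field K] {m : ℕ} {lam : K}

/-- The trivial paths and the arrows generate the algebra. -/
theorem S_induction {p : S K m lam → Prop} (hsmul : ∀ (k : K) x, p x → p (k • x))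
    (he : ∀ i, p (e K m lam i)) (ha : ∀ a, p (arrow K m lam a))
    (hadd : ∀ x y, p x → p y → p (x + y)) (hmul : ∀ x y, p x → p y → p (x * y)) (x) : p x := by
  have h1 : p 1 := by
    rw [← sum_e, sum_vertex]
    exact hadd _ _ (hadd _ _ (hadd _ _ (hadd _ _ (hadd _ _ (he _) (he _)) (he _)) (he _))
      (he _)) (he _)
  obtain ⟨x, rfl⟩ := RingQuot.mkAlgHom_surjective K (Rel K m lam) x
  induction x using FreeAlgebra.induction with
  | grade0 r =>
    rw [AlgHom.commutes, Algebra.algebraMap_eq_smul_one]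
    exact hsmul _ _ h1
  | grade1 x =>
    rcases x with i | a
    · exact he i
    · exact ha a
  | mul x y hx hy => rw [map_mul]; exact hmul _ _ hx hy
  | add x y hx hy => rw [map_add]; exact hadd _ _ hx hy

/-- Reduces the spanning theorem for e₁S to finitely many products of a short path and a generator.
-/
theorem mul_mem_of_generators {U : Submodule K (S K m lam)}
    (he : ∀ i, ∀ u ∈ U, u * e K m lam i ∈ U) (ha : ∀ a, ∀ u ∈ U, u * arrow K m lam a ∈ U)
    {u : S K m lam} (hu : u ∈ U) (x : S K m lam) : u * x ∈ U := by
  revert u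
  refine S_induction (p := fun x => ∀ {u}, u ∈ U → u * x ∈ U) ?_ ?_ ?_ ?_ ?_ x
  · intro k x hx u hu
    rw [mul_smul_comm]
    exact U.smul_mem _ (hx hu)
  · exact fun i u hu => he i u hu
  · exact fun i u hu => ha i u hu
  · intro x y hx hy u hu
    rw [mul_add]
    exact U.add_mem (hx hu) (hy hu)
  · intro x y hx hy u hu
    rw [← mul_assoc]
    exact hy (hx hu)

/-- Every element is a combination of trivial paths and of right multiples of arrows. -/
theorem exists_eq_sum_arrow_mul (x : S K m lam) : ∃ (κ : Vertex → K) (y : Arrow → S K m lam),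
    x = ∑ i, κ i • e K m lam i + ∑ a, arrow K m lam a * y a := by
  refine S_induction (p := fun x => ∃ (κ : Vertex → K) (y : Arrow → S K m lam),
    x = ∑ i, κ i • e K m lam i + ∑ a, arrow K m lam a * y a) ?_ ?_ ?_ ?_ ?_ x
  · rintro k _ ⟨κ, y, rfl⟩
    refine ⟨k • κ, k • y, ?_⟩
    simp only [smul_add, Finset.smul_sum, Pi.smul_apply, smul_smul, smul_eq_mul, mul_smul_comm]
  · intro i
    refine ⟨Pi.single i 1, 0, ?_⟩
    simp [Pi.single_apply]
  · intro a
    refine ⟨0, Pi.single a 1, ?_⟩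
    simp [Pi.single_apply]
  · rintro _ _ ⟨κ, y, rfl⟩ ⟨κ', y', rfl⟩
    refine ⟨κ + κ', y + y', ?_⟩
    simp only [Pi.add_apply, add_smul, mul_add, Finset.sum_add_distrib]
    abel
  · rintro _ x' ⟨κ, y, rfl⟩ ⟨κ', y', h⟩
    -- In κᵢeᵢx' the factor x' is expanded once more, and eᵢ selects the arrows that start at i,
    -- hence the weight κ at the source. The part already beginning with an arrow just absorbs x'.
    refine ⟨κ * κ', fun a => κ a.src • y' a + y a * x', ?_⟩
    have h1 (i : Vertex) : e K m lam i * x' = κ' i • e K m lam i +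
        ∑ a : Arrow, if i = a.src then arrow K m lam a * y' a else 0 := by
      rw [h, mul_add, Finset.mul_sum, Finset.mul_sum]
      simp only [mul_smul_comm, e_mul_e, ← mul_assoc, e_mul_arrow]
      simp
    have h2 : ∀ i : Vertex, κ i • e K m lam i * x' = (κ * κ') i • e K m lam i +
        ∑ a : Arrow, if i = a.src then arrow K m lam a * (κ a.src • y' a) else 0 := by
      intro i
      rw [smul_mul_assoc, h1, smul_add, smul_smul, Finset.smul_sum]
      congr 1
      refine Finset.sum_congr rfl fun a _ => ?_
      split_ifs with hi
      · rw [mul_smul_comm, hi]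
      · simp
    rw [add_mul, Finset.sum_mul, Finset.sum_congr rfl fun i _ => h2 i, Finset.sum_add_distrib,
      Finset.sum_comm, Finset.sum_mul]
    simp only [mul_add, Finset.sum_add_distrib, mul_assoc]
    simp [add_assoc]

/-- Every element is a combination of trivial paths and of left multiples of arrows. -/
theorem exists_eq_sum_mul_arrow (x : S K m lam) : ∃ (κ : Vertex → K) (y : Arrow → S K m lam),
    x = ∑ i, κ i • e K m lam i + ∑ a, y a * arrow K m lam a := by
  refine S_induction (p := fun x => ∃ (κ : Vertex → K) (y : Arrow → S K m lam),
    x = ∑ i, κ i • e K m lam i + ∑ a, y a * arrow K m lam a) ?_ ?_ ?_ ?_ ?_ x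
  · rintro k _ ⟨κ, y, rfl⟩
    refine ⟨k • κ, k • y, ?_⟩
    simp only [smul_add, Finset.smul_sum, Pi.smul_apply, smul_smul, smul_eq_mul, smul_mul_assoc]
  · intro i
    refine ⟨Pi.single i 1, 0, ?_⟩
    simp [Pi.single_apply]
  · intro a
    refine ⟨0, Pi.single a 1, ?_⟩
    simp [Pi.single_apply]
  · rintro _ _ ⟨κ, y, rfl⟩ ⟨κ', y', rfl⟩
    refine ⟨κ + κ', y + y', ?_⟩
    simp only [Pi.add_apply, add_smul, add_mul, Finset.sum_add_distrib]
    abel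
  · rintro x' _ ⟨κ', y', h⟩ ⟨κ, y, rfl⟩
    refine ⟨κ' * κ, fun a => κ a.tgt • y' a + x' * y a, ?_⟩
    have h1 (i : Vertex) : x' * e K m lam i = κ' i • e K m lam i +
        ∑ a : Arrow, if a.tgt = i then y' a * arrow K m lam a else 0 := by
      rw [h, add_mul, Finset.sum_mul, Finset.sum_mul]
      simp only [smul_mul_assoc, e_mul_e, mul_assoc, arrow_mul_e]
      simp
    have h2 : ∀ i : Vertex, x' * κ i • e K m lam i = (κ' * κ) i • e K m lam i +
        ∑ a : Arrow, if a.tgt = i then (κ a.tgt • y' a) * arrow K m lam a else 0 := by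
      intro i
      rw [mul_smul_comm, h1, smul_add, smul_smul, Finset.smul_sum]
      congr 1
      · simp [mul_comm]
      refine Finset.sum_congr rfl fun a _ => ?_
      split_ifs with hi
      · rw [smul_mul_assoc, hi]
      · simp
    rw [mul_add, Finset.mul_sum, Finset.sum_congr rfl fun i _ => h2 i, Finset.sum_add_distrib,
      Finset.sum_comm, Finset.mul_sum]
    simp only [add_mul, Finset.sum_add_distrib, mul_assoc]
    simp [add_assoc]

end Structure

end HigherSpherical

namespace HigherSpherical

/-! ### Spanning sets of e₁S, and of e₄S and e₅S away from their own vertex -/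

section Spanning

variable {K : Type u} [Field K] {m : ℕ} {lam : K}

local notation "E1" => e K m lam Vertex.v1
local notation "A1" => arrow K m lam Arrow.α
local notation "B1" => arrow K m lam Arrow.β
local notation "G1" => arrow K m lam Arrow.γ
local notation "S1" => arrow K m lam Arrow.σ
local notation "R1" => arrow K m lam Arrow.ρ
local notation "O1" => arrow K m lam Arrow.ω
local notation "N1" => arrow K m lam Arrow.ν
local notation "D1" => arrow K m lam Arrow.δ
local notation "C1" => cyc K m lam

variable (K m lam) in
/-- The polynomials in the cycle `αβγσ`. -/
noncomputable def cycPoly : Submodule K (S K m lam) :=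
  Subalgebra.toSubmodule (Algebra.adjoin K {C1})

variable (K m lam) in
/-- Short paths which start at the vertex `1`. -/
def shortPaths : Set (S K m lam) :=
  {E1, A1, R1, A1 * B1, R1 * O1, A1 * B1 * G1, A1 * B1 * N1}

variable (K m lam) in
/-- The span of the products of a polynomial in `αβγσ` and a short path. -/
noncomputable def cycSpan : Submodule K (S K m lam) :=
  cycPoly K m lam * Submodule.span K (shortPaths K m lam)

lemma cycPoly_mul {x y : S K m lam} (hx : x ∈ cycPoly K m lam) (hy : y ∈ cycPoly K m lam) :
    x * y ∈ cycPoly K m lam := (Algebra.adjoin K {C1}).mul_mem hx hy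

lemma cyc_pow_mem_cycPoly (k : ℕ) : C1 ^ k ∈ cycPoly K m lam :=
  (Algebra.adjoin K {C1}).pow_mem (Algebra.subset_adjoin rfl) k

lemma cyc_mem_cycPoly : C1 ∈ cycPoly K m lam := Algebra.subset_adjoin rfl

lemma cyc_pow_mul_e1 {k : ℕ} (hk : k ≠ 0) : C1 ^ k * E1 = C1 ^ k := by
  obtain ⟨k, rfl⟩ := Nat.exists_eq_succ_of_ne_zero hk
  rw [Nat.succ_eq_add_one, pow_succ, mul_assoc, cyc_mul_e1]

lemma one_mem_cycPoly : 1 ∈ cycPoly K m lam := (Algebra.adjoin K {C1}).one_mem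

lemma cycPoly_mul_cycSpan {x y : S K m lam} (hx : x ∈ cycPoly K m lam)
    (hy : y ∈ cycSpan K m lam) : x * y ∈ cycSpan K m lam := by
  refine Submodule.mul_induction_on hy (fun z hz w hw => ?_) (fun u v hu hv => ?_)
  · rw [← mul_assoc]
    exact Submodule.mul_mem_mul (cycPoly_mul hx hz) hw
  · rw [mul_add]
    exact add_mem hu hv

/-- Right multiplication commutes with the left action of K[C], so only the short paths have to be
tested. The target V is left free so that it can be cut down to the span of the paths ending at a
chosen vertex. -/
lemma mul_mem_cycPoly_mul {V : Submodule K (S K m lam)} {s : S K m lam}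
    (h : ∀ w ∈ shortPaths K m lam, w * s ∈ V) {u : S K m lam} (hu : u ∈ cycSpan K m lam) :
    u * s ∈ cycPoly K m lam * V := by
  refine Submodule.mul_induction_on hu (fun z hz w hw => ?_) (fun u v hu hv => ?_)
  · rw [mul_assoc]
    refine Submodule.mul_mem_mul hz ?_
    induction hw using Submodule.span_induction with
    | mem w hw => exact h w hw
    | zero => simp
    | add x y _ _ hx hy => rw [add_mul]; exact add_mem hx hy
    | smul k x _ hx => rw [smul_mul_assoc]; exact V.smul_mem _ hx
  · rw [add_mul]
    exact add_mem hu hv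

lemma mul_mem_cycSpan {s : S K m lam}
    (h : ∀ w ∈ shortPaths K m lam, w * s ∈ cycSpan K m lam) {u : S K m lam}
    (hu : u ∈ cycSpan K m lam) : u * s ∈ cycSpan K m lam := by
  refine Submodule.mul_induction_on (mul_mem_cycPoly_mul h hu) (fun z hz w hw => ?_)
    (fun u v hu hv => add_mem hu hv)
  exact cycPoly_mul_cycSpan hz hw

lemma shortPaths_subset : shortPaths K m lam ⊆ cycSpan K m lam := by
  intro w hw
  rw [← one_mul w]
  exact Submodule.mul_mem_mul one_mem_cycPoly (Submodule.subset_span hw)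

lemma cycSpan_mul_e (i : Vertex) (u : S K m lam) (hu : u ∈ cycSpan K m lam) :
    u * e K m lam i ∈ cycSpan K m lam := by
  refine mul_mem_cycSpan (fun w hw => ?_) hu
  have h : w * e K m lam i = w ∨ w * e K m lam i = 0 := by
    rcases hw with rfl | rfl | rfl | rfl | rfl | rfl | rfl <;>
    simp only [mul_assoc, arrow_mul_e, e_mul_e] <;> split_ifs <;> simp_all
  rcases h with h | h <;> rw [h]
  · exact shortPaths_subset hw
  · exact zero_mem _

/-- A short path extended by a composable arrow leaves the list only in four cases: ρωγ and ρων are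
rewritten by `rel4` and `rel5`, αβγσ is C, and αβνδ is C + λCᵐ. -/
lemma cycSpan_mul_arrow (hm : 2 ≤ m) (a : Arrow) (u : S K m lam)
    (hu : u ∈ cycSpan K m lam) : u * arrow K m lam a ∈ cycSpan K m lam := by
  have h0 (w : S K m lam) {b : Arrow} (h : b.tgt ≠ a.src) :
      w * arrow K m lam b * arrow K m lam a ∈ cycSpan K m lam := by
    rw [mul_assoc, arrow_mul_arrow_of_ne h, mul_zero]
    exact zero_mem _
  have hc : (C1 + lam • C1 ^ m) ∈ cycSpan K m lam := by
    have h : C1 + lam • C1 ^ m = (C1 + lam • C1 ^ m) * E1 := by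
      rw [add_mul, smul_mul_assoc, cyc_mul_e1, cyc_pow_mul_e1 (by omega)]
    rw [h]
    refine Submodule.mul_mem_mul (add_mem cyc_mem_cycPoly ?_)
      (Submodule.subset_span (by simp [shortPaths]))
    exact Submodule.smul_mem _ _ (cyc_pow_mem_cycPoly _)
  refine mul_mem_cycSpan (fun w hw => ?_) hu
  rcases hw with rfl | rfl | rfl | rfl | rfl | rfl | rfl
  · rw [e_mul_arrow]
    split_ifs with h
    · cases a <;> simp [Arrow.src] at h <;> exact shortPaths_subset (by simp [shortPaths])
    · exact zero_mem _
  · by_cases h : Arrow.α.tgt = a.src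
    · cases a <;> simp [Arrow.src, Arrow.tgt] at h
      exact shortPaths_subset (by simp [shortPaths])
    · rw [← one_mul A1]
      exact h0 _ h
  · by_cases h : Arrow.ρ.tgt = a.src
    · cases a <;> simp [Arrow.src, Arrow.tgt] at h
      exact shortPaths_subset (by simp [shortPaths])
    · rw [← one_mul R1]
      exact h0 _ h
  · by_cases h : Arrow.β.tgt = a.src
    · cases a <;> simp [Arrow.src, Arrow.tgt] at h <;>
      exact shortPaths_subset (by simp [shortPaths])
    · exact h0 _ h
  · by_cases h : Arrow.ω.tgt = a.src
    · cases a <;> simp [Arrow.src, Arrow.tgt] at h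
      · rw [rel4]
        refine add_mem (shortPaths_subset (by simp [shortPaths])) (Submodule.smul_mem _ _ ?_)
        exact Submodule.mul_mem_mul (cyc_pow_mem_cycPoly _)
          (Submodule.subset_span (by simp [shortPaths]))
      · rw [← rel5]
        exact shortPaths_subset (by simp [shortPaths])
    · exact h0 _ h
  · by_cases h : Arrow.γ.tgt = a.src
    · cases a <;> simp [Arrow.src, Arrow.tgt] at h
      change C1 ∈ _
      rw [← cyc_mul_e1]
      exact Submodule.mul_mem_mul cyc_mem_cycPoly (Submodule.subset_span (by simp [shortPaths]))
    · exact h0 _ h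
  · by_cases h : Arrow.ν.tgt = a.src
    · cases a <;> simp [Arrow.src, Arrow.tgt] at h
      rw [alpha_beta_nu_delta hm]
      exact hc
    · exact h0 _ h

/-- The right ideal `e₁S` is spanned by the products of a polynomial in `αβγσ` and a short
path. -/
theorem e1_mul_mem_cycSpan (hm : 2 ≤ m) (x : S K m lam) : E1 * x ∈ cycSpan K m lam :=
  mul_mem_of_generators cycSpan_mul_e (cycSpan_mul_arrow hm)
    (shortPaths_subset (by simp [shortPaths])) x

lemma exists_aeval_of_mem {w x : S K m lam} (h : x ∈ cycPoly K m lam * Submodule.span K {w}) :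
    ∃ p : Polynomial K, x = Polynomial.aeval C1 p * w := by
  obtain ⟨z, hz, rfl⟩ := Submodule.mem_mul_span_singleton.1 h
  rw [cycPoly, Subalgebra.mem_toSubmodule, Algebra.adjoin_singleton_eq_range_aeval] at hz
  obtain ⟨p, rfl⟩ := hz
  exact ⟨p, rfl⟩

/-- `e₁Seᵢ` is cyclic over the polynomials in `αβγσ` if the short paths from `1` to `i` are
multiples of a single one. -/
lemma exists_aeval_of_shortPaths (hm : 2 ≤ m) (i : Vertex) (w : S K m lam)
    (h : ∀ w' ∈ shortPaths K m lam, w' * e K m lam i = w ∨ w' * e K m lam i = 0)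
    (x : S K m lam) :
    ∃ p : Polynomial K, E1 * x * e K m lam i = Polynomial.aeval C1 p * w := by
  refine exists_aeval_of_mem (mul_mem_cycPoly_mul (fun w' hw' => ?_) (e1_mul_mem_cycSpan hm x))
  rcases h w' hw' with h | h <;> rw [h]
  · exact Submodule.subset_span rfl
  · exact zero_mem _

lemma exists_e1_mul_e1 (hm : 2 ≤ m) (x : S K m lam) :
    ∃ p : Polynomial K, E1 * x * e K m lam .v1 = Polynomial.aeval C1 p * E1 := by
  refine exists_aeval_of_shortPaths hm _ _ (fun w hw => ?_) x
  rcases hw with rfl | rfl | rfl | rfl | rfl | rfl | rfl <;>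
    simp [mul_assoc, arrow_mul_e, e_mul_e, Arrow.tgt]

lemma exists_e1_mul_e2 (hm : 2 ≤ m) (x : S K m lam) :
    ∃ p : Polynomial K, E1 * x * e K m lam .v2 = Polynomial.aeval C1 p * A1 := by
  refine exists_aeval_of_shortPaths hm _ _ (fun w hw => ?_) x
  rcases hw with rfl | rfl | rfl | rfl | rfl | rfl | rfl <;>
    simp [mul_assoc, arrow_mul_e, e_mul_e, Arrow.tgt]

lemma exists_e1_mul_e4 (hm : 2 ≤ m) (x : S K m lam) :
    ∃ p : Polynomial K, E1 * x * e K m lam .v4 = Polynomial.aeval C1 p * (A1 * B1 * G1) := by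
  refine exists_aeval_of_shortPaths hm _ _ (fun w hw => ?_) x
  rcases hw with rfl | rfl | rfl | rfl | rfl | rfl | rfl <;>
    simp [mul_assoc, arrow_mul_e, e_mul_e, Arrow.tgt]

lemma exists_e1_mul_e6 (hm : 2 ≤ m) (x : S K m lam) :
    ∃ p : Polynomial K, E1 * x * e K m lam .v6 = Polynomial.aeval C1 p * R1 := by
  refine exists_aeval_of_shortPaths hm _ _ (fun w hw => ?_) x
  rcases hw with rfl | rfl | rfl | rfl | rfl | rfl | rfl <;>
    simp [mul_assoc, arrow_mul_e, e_mul_e, Arrow.tgt]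

lemma exists_e1_mul_e3 (hm : 2 ≤ m) (x : S K m lam) :
    ∃ p q : Polynomial K, E1 * x * e K m lam .v3 =
      Polynomial.aeval C1 p * (A1 * B1) + Polynomial.aeval C1 q * (R1 * O1) := by
  have h := mul_mem_cycPoly_mul (s := e K m lam .v3)
    (V := Submodule.span K {A1 * B1} ⊔ Submodule.span K {R1 * O1}) (fun w hw => ?_)
    (e1_mul_mem_cycSpan hm x)
  · rw [Submodule.mul_sup] at h
    obtain ⟨y, hy, z, hz, h⟩ := Submodule.mem_sup.1 h
    obtain ⟨p, rfl⟩ := exists_aeval_of_mem hy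
    obtain ⟨q, rfl⟩ := exists_aeval_of_mem hz
    exact ⟨p, q, h.symm⟩
  · have h1 : A1 * B1 ∈ Submodule.span K {A1 * B1} ⊔ Submodule.span K {R1 * O1} :=
      Submodule.mem_sup_left (Submodule.subset_span rfl)
    have h2 : R1 * O1 ∈ Submodule.span K {A1 * B1} ⊔ Submodule.span K {R1 * O1} :=
      Submodule.mem_sup_right (Submodule.subset_span rfl)
    rcases hw with rfl | rfl | rfl | rfl | rfl | rfl | rfl <;>
      simp [mul_assoc, arrow_mul_e, e_mul_e, Arrow.tgt, h1, h2]

/-- As Cρω = Cαβ, only the constant term of q still sees ρω; thus e₁Se₃ = K[C]αβ + Kρω. -/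
lemma cycPoly_mul_rho_omega (hm : 2 ≤ m) (q : Polynomial K) :
    Polynomial.aeval C1 q * (R1 * O1) =
      Polynomial.aeval C1 (Polynomial.X * q.divX) * (A1 * B1) + q.coeff 0 • (R1 * O1) := by
  conv_lhs => rw [← Polynomial.divX_mul_X_add q]
  rw [map_add, map_mul, Polynomial.aeval_X, Polynomial.aeval_C, add_mul, mul_assoc,
    cyc_mul_rho_omega hm, mul_comm Polynomial.X, map_mul, Polynomial.aeval_X, mul_assoc,
    Algebra.smul_def]

/-- The vertex 3 is the only one reached by two independent short paths. After multiplication by σ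
(and by δ in `exists_delta_mul_e3`) one generator suffices, as the injectivity criterion requires.
-/
lemma exists_sigma_mul_e3 (hm : 2 ≤ m) (x : S K m lam) :
    ∃ p : Polynomial K, S1 * (E1 * x * e K m lam .v3) =
      S1 * Polynomial.aeval C1 p * (A1 * B1) := by
  obtain ⟨p, q, h⟩ := exists_e1_mul_e3 hm x
  -- The last summand records σρω = σ(1 + λCᵐ⁻¹)αβ for the constant term of q.
  refine ⟨p + Polynomial.X * q.divX + Polynomial.C (q.coeff 0) *
    (1 + Polynomial.C lam * Polynomial.X ^ (m - 1)), ?_⟩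
  rw [h, cycPoly_mul_rho_omega hm, mul_add, mul_add, mul_smul_comm, sigma_rho_omega]
  simp only [map_add, map_mul, Polynomial.aeval_X, Polynomial.aeval_C, map_pow, ← Algebra.smul_def,
    mul_add, add_mul, mul_assoc, smul_mul_assoc, mul_smul_comm, mul_one, smul_add]
  rw [smul_comm lam]
  abel

lemma exists_delta_mul_e3 (hm : 2 ≤ m) (x : S K m lam) :
    ∃ p : Polynomial K, D1 * (E1 * x * e K m lam .v3) =
      D1 * Polynomial.aeval C1 p * (A1 * B1) := by
  obtain ⟨p, q, h⟩ := exists_e1_mul_e3 hm x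
  refine ⟨p + Polynomial.X * q.divX + Polynomial.C (q.coeff 0), ?_⟩
  have h6 : D1 * (R1 * O1) = D1 * (A1 * B1) := by
    rw [← mul_assoc, ← rel6, mul_assoc]
  rw [h, cycPoly_mul_rho_omega hm, mul_add, mul_add, mul_smul_comm, h6]
  simp only [map_add, map_mul, Polynomial.aeval_X, Polynomial.aeval_C,
    mul_add, add_mul, mul_assoc, smul_mul_assoc, mul_smul_comm,
    Algebra.algebraMap_eq_smul_one, mul_one]
  abel

/-- The right ideal `e₄S` is spanned by `e₄` and `σS`. -/
lemma exists_e4_mul_e {i : Vertex} (hi : i ≠ .v4) (x : S K m lam) :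
    ∃ y, e K m lam .v4 * x * e K m lam i = S1 * (E1 * y * e K m lam i) := by
  obtain ⟨κ, y, rfl⟩ := exists_eq_sum_arrow_mul x
  refine ⟨y .σ, ?_⟩
  rw [sum_vertex, sum_arrow]
  simp only [mul_add, mul_smul_comm, e_mul_e, ← mul_assoc, e_mul_arrow, arrow_mul_e]
  simp [Arrow.src, Arrow.tgt, add_mul, e_mul_e, hi.symm]

/-- The right ideal `e₅S` is spanned by `e₅` and `δS`. -/
lemma exists_e5_mul_e {i : Vertex} (hi : i ≠ .v5) (x : S K m lam) :
    ∃ y, e K m lam .v5 * x * e K m lam i = D1 * (E1 * y * e K m lam i) := by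
  obtain ⟨κ, y, rfl⟩ := exists_eq_sum_arrow_mul x
  refine ⟨y .δ, ?_⟩
  rw [sum_vertex, sum_arrow]
  simp only [mul_add, mul_smul_comm, e_mul_e, ← mul_assoc, e_mul_arrow, arrow_mul_e]
  simp [Arrow.src, Arrow.tgt, add_mul, e_mul_e, hi.symm]

/-- The left ideal `Se₄` is spanned by `e₄` and `Sγ`. -/
lemma exists_e_mul_e4 {i : Vertex} (hi : i ≠ .v4) (x : S K m lam) :
    ∃ y, e K m lam i * x * e K m lam .v4 = e K m lam i * y * G1 := by
  obtain ⟨κ, y, rfl⟩ := exists_eq_sum_mul_arrow x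
  refine ⟨y .γ, ?_⟩
  rw [sum_vertex, sum_arrow]
  simp only [mul_add, add_mul, mul_smul_comm, smul_mul_assoc, e_mul_e, mul_assoc, arrow_mul_e]
  simp [Arrow.tgt, e_mul_e, hi]

/-- The left ideal `Se₅` is spanned by `e₅` and `Sν`. -/
lemma exists_e_mul_e5 {i : Vertex} (hi : i ≠ .v5) (x : S K m lam) :
    ∃ y, e K m lam i * x * e K m lam .v5 = e K m lam i * y * N1 := by
  obtain ⟨κ, y, rfl⟩ := exists_eq_sum_mul_arrow x
  refine ⟨y .ν, ?_⟩
  rw [sum_vertex, sum_arrow]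
  simp only [mul_add, add_mul, mul_smul_comm, smul_mul_assoc, e_mul_e, mul_assoc, arrow_mul_e]
  simp [Arrow.tgt, e_mul_e, hi]

end Spanning

end HigherSpherical

namespace HigherSpherical

/-! ### The ideal generated by the arrows is nilpotent -/

section Augmentation

open scoped Pointwise

variable {K : Type u} [Field K] {m : ℕ} {lam : K}

variable (K m lam) in
/-- The augmentation which kills the arrows. -/
noncomputable def augmentation : S K m lam →ₐ[K] (Vertex → K) :=
  RingQuot.liftAlgHom K ⟨FreeAlgebra.lift K (Sum.elim (fun i => Pi.single i 1) 0), by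
    have hv (i : Vertex) : FreeAlgebra.lift K (Sum.elim (fun i => Pi.single i 1) 0) (vtx K i) =
        (Pi.single i 1 : Vertex → K) := by simp [vtx]
    have ha (a : Arrow) : FreeAlgebra.lift K (Sum.elim (fun i => Pi.single i 1) 0) (arr K a) =
        (0 : Vertex → K) := by simp [arr]
    intro x y h
    cases h with
    | vtx_mul_vtx i j =>
      rw [map_mul, hv, hv]
      split_ifs with h
      · subst h
        rw [hv, ← Pi.single_mul, one_mul]
      · rw [map_zero]
        ext k
        rw [Pi.mul_apply, Pi.single_apply, Pi.single_apply, Pi.zero_apply]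
        split_ifs <;> simp_all
    | sum_vtx =>
      rw [map_sum, map_one]
      ext k
      simp [hv, Pi.single_apply]
    | _ => simp [ha]⟩

lemma augmentation_e (i : Vertex) :
    augmentation K m lam (e K m lam i) = Pi.single i 1 := by
  simp [augmentation, e, vtx]

lemma augmentation_arrow (a : Arrow) :
    augmentation K m lam (arrow K m lam a) = 0 := by
  simp [augmentation, arrow, arr]

variable (K m lam) in
/-- The span of the arrows. -/
noncomputable def arrowSpan : Submodule K (S K m lam) :=
  Submodule.span K (Set.range (arrow K m lam))

lemma arrow_mem_arrowSpan (a : Arrow) : arrow K m lam a ∈ arrowSpan K m lam :=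
  Submodule.subset_span ⟨a, rfl⟩

lemma mem_arrowSpan_mul_top {x : S K m lam}
    (hx : augmentation K m lam x = 0) : x ∈ arrowSpan K m lam * ⊤ := by
  obtain ⟨κ, y, rfl⟩ := exists_eq_sum_arrow_mul x
  have h (i : Vertex) : κ i = 0 := by
    have := congr_fun hx i
    simpa [augmentation_e, augmentation_arrow, Pi.single_apply] using this
  simp only [h, zero_smul, Finset.sum_const_zero, zero_add]
  exact sum_mem fun a _ => Submodule.mul_mem_mul (arrow_mem_arrowSpan a) trivial

/-- The right ideal generated by the arrows is two-sided. This allows all arrow factors of a power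
to be moved to the left, so that nilpotency becomes a statement about paths. -/
lemma top_mul_arrowSpan_le : ⊤ * arrowSpan K m lam ≤ arrowSpan K m lam * ⊤ := by
  rw [Submodule.mul_le]
  intro x _ a ha
  induction ha using Submodule.span_induction with
  | mem _ h =>
    obtain ⟨a, rfl⟩ := h
    obtain ⟨κ, y, rfl⟩ := exists_eq_sum_arrow_mul x
    rw [add_mul, Finset.sum_mul, Finset.sum_mul]
    refine add_mem (sum_mem fun i _ => ?_) (sum_mem fun b _ => ?_)
    · rw [smul_mul_assoc, e_mul_arrow]
      refine Submodule.smul_mem _ _ ?_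
      split_ifs
      · rw [← mul_one (arrow K m lam a)]
        exact Submodule.mul_mem_mul (arrow_mem_arrowSpan a) trivial
      · exact zero_mem _
    · rw [mul_assoc]
      exact Submodule.mul_mem_mul (arrow_mem_arrowSpan b) trivial
  | zero => simp
  | add u v _ _ hu hv => rw [mul_add]; exact add_mem hu hv
  | smul k u _ hu => rw [mul_smul_comm]; exact Submodule.smul_mem _ _ hu

lemma arrowSpan_mul_top_pow_le (n : ℕ) :
    (arrowSpan K m lam * ⊤) ^ n ≤ arrowSpan K m lam ^ n * ⊤ := by
  have htop : (⊤ : Submodule K (S K m lam)) * ⊤ ≤ ⊤ := le_top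
  have h (n : ℕ) : ⊤ * arrowSpan K m lam ^ n ≤ arrowSpan K m lam ^ n * ⊤ := by
    induction n with
    | zero => simp
    | succ n ih =>
      calc _ = ⊤ * arrowSpan K m lam ^ n * arrowSpan K m lam := by rw [pow_succ, mul_assoc]
        _ ≤ arrowSpan K m lam ^ n * ⊤ * arrowSpan K m lam := mul_le_mul' ih le_rfl
        _ = arrowSpan K m lam ^ n * (⊤ * arrowSpan K m lam) := mul_assoc _ _ _
        _ ≤ arrowSpan K m lam ^ n * (arrowSpan K m lam * ⊤) :=
          mul_le_mul' le_rfl top_mul_arrowSpan_le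
        _ = _ := by rw [pow_succ, mul_assoc]
  induction n with
  | zero =>
    rw [pow_zero, pow_zero, one_mul]
    exact le_top
  | succ n ih =>
    calc _ = (arrowSpan K m lam * ⊤) ^ n * (arrowSpan K m lam * ⊤) := pow_succ _ _
      _ ≤ arrowSpan K m lam ^ n * ⊤ * (arrowSpan K m lam * ⊤) := mul_le_mul' ih le_rfl
      _ = arrowSpan K m lam ^ n * (⊤ * arrowSpan K m lam) * ⊤ := by simp only [mul_assoc]
      _ ≤ arrowSpan K m lam ^ n * (arrowSpan K m lam * ⊤) * ⊤ :=
        mul_le_mul' (mul_le_mul' le_rfl top_mul_arrowSpan_le) le_rfl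
      _ = arrowSpan K m lam ^ (n + 1) * (⊤ * ⊤) := by simp only [pow_succ, mul_assoc]
      _ ≤ _ := mul_le_mul' le_rfl htop

/-- If all arrows from `i` lead to vertices from which no path of length `n` is nonzero, then no
path of length `n + 1` from `i` is nonzero. -/
lemma e_mul_eq_zero_of_tgt {i : Vertex} {n : ℕ}
    (h : ∀ a : Arrow, a.src = i → ∀ z ∈ arrowSpan K m lam ^ n, e K m lam a.tgt * z = 0) :
    ∀ z ∈ arrowSpan K m lam ^ (n + 1), e K m lam i * z = 0 := by
  intro z hz
  rw [pow_succ'] at hz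
  refine Submodule.mul_induction_on hz (fun x hx y hy => ?_) (fun u v hu hv => ?_)
  · induction hx using Submodule.span_induction with
    | mem _ hx =>
      obtain ⟨a, rfl⟩ := hx
      rw [← mul_assoc, e_mul_arrow]
      split_ifs with hi
      · rw [← arrow_mul_e_tgt, mul_assoc, h a hi.symm y hy, mul_zero]
      · rw [zero_mul]
    | zero => simp
    | add u v _ _ hu hv => rw [add_mul, mul_add, hu, hv, add_zero]
    | smul k u _ hu => rw [smul_mul_assoc, mul_smul_comm, hu, smul_zero]
  · rw [mul_add, hu, hv, add_zero]

/-- Only αβγσ, αβνδ, ρωγσ and ρωνδ are composable from the vertex 1; the first is C and the others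
are C + λCᵐ. -/
lemma e1_mul_four_arrows (hm : 2 ≤ m) (a b c d : Arrow) :
    ∃ k l : K, e K m lam .v1 *
      (arrow K m lam a * arrow K m lam b * arrow K m lam c * arrow K m lam d) =
        k • cyc K m lam + l • cyc K m lam ^ m := by
  have h0 (x : S K m lam) (hx : x = 0) : ∃ k l : K, x = k • cyc K m lam + l • cyc K m lam ^ m :=
    ⟨0, 0, by simp [hx]⟩
  have h1 (x : S K m lam) (hx : x = cyc K m lam + lam • cyc K m lam ^ m) :
      ∃ k l : K, x = k • cyc K m lam + l • cyc K m lam ^ m := ⟨1, lam, by simp [hx]⟩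
  by_cases ha : a.src = .v1
  swap
  · exact h0 _ (by simp only [← mul_assoc, e_mul_arrow, if_neg (Ne.symm ha), zero_mul])
  have he : e K m lam .v1 * arrow K m lam a = arrow K m lam a := by
    rw [e_mul_arrow, if_pos ha.symm]
  by_cases hb : a.tgt = b.src
  swap
  · exact h0 _ (by rw [arrow_mul_arrow_of_ne hb]; simp)
  by_cases hc : b.tgt = c.src
  swap
  · exact h0 _ (by rw [mul_assoc (arrow K m lam a), arrow_mul_arrow_of_ne hc]; simp)
  by_cases hd : c.tgt = d.src
  swap
  · exact h0 _ (by rw [mul_assoc _ (arrow K m lam c), arrow_mul_arrow_of_ne hd]; simp)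
  simp only [← mul_assoc, he]
  cases a <;> simp only [Arrow.src, reduceCtorEq] at ha <;>
  cases b <;> simp only [Arrow.src, Arrow.tgt, reduceCtorEq] at hb <;>
  cases c <;> simp only [Arrow.src, Arrow.tgt, reduceCtorEq] at hc <;>
  cases d <;> simp only [Arrow.src, Arrow.tgt, reduceCtorEq] at hd
  · exact ⟨1, 0, by simp [cyc]⟩
  · exact h1 _ (alpha_beta_nu_delta hm)
  · exact h1 _ (rho_omega_gamma_sigma hm)
  · exact h1 _ (rho_omega_nu_delta hm)

lemma e1_mul_arrowSpan_pow_four (hm : 2 ≤ m) (z : S K m lam)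
    (hz : z ∈ arrowSpan K m lam ^ 4) :
    ∃ k l : K, e K m lam .v1 * z = k • cyc K m lam + l • cyc K m lam ^ m := by
  have h : arrowSpan K m lam ^ 4 = Submodule.span K (Set.range (arrow K m lam) *
      Set.range (arrow K m lam) * Set.range (arrow K m lam) * Set.range (arrow K m lam)) := by
    simp only [pow_succ, pow_zero, one_mul, arrowSpan, Submodule.span_mul_span]
  rw [h] at hz
  induction hz using Submodule.span_induction with
  | mem _ hx =>
    obtain ⟨_, ⟨_, ⟨_, ⟨a, rfl⟩, _, ⟨b, rfl⟩, rfl⟩, _, ⟨c, rfl⟩, rfl⟩, _, ⟨d, rfl⟩, rfl⟩ := hx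
    exact e1_mul_four_arrows hm a b c d
  | zero => exact ⟨0, 0, by simp⟩
  | add u v _ _ hu hv =>
    obtain ⟨k, l, hu⟩ := hu
    obtain ⟨k', l', hv⟩ := hv
    exact ⟨k + k', l + l', by rw [mul_add, hu, hv, add_smul, add_smul]; abel⟩
  | smul r u _ hu =>
    obtain ⟨k, l, hu⟩ := hu
    exact ⟨r * k, r * l, by rw [mul_smul_comm, hu, smul_add, smul_smul, smul_smul]⟩

lemma e1_mul_arrowSpan_pow (hm : 2 ≤ m) (n : ℕ) :
    ∀ z ∈ arrowSpan K m lam ^ (4 * n), ∃ y, e K m lam .v1 * z = cyc K m lam ^ n * y := by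
  induction n with
  | zero => exact fun z _ => ⟨e K m lam .v1 * z, by simp⟩
  | succ n ih =>
    intro z hz
    rw [show 4 * (n + 1) = 4 + 4 * n by ring, pow_add] at hz
    refine Submodule.mul_induction_on hz (fun x hx y hy => ?_) (fun u v hu hv => ?_)
    · obtain ⟨k, l, h⟩ := e1_mul_arrowSpan_pow_four hm x hx
      obtain ⟨w, hw⟩ := ih y hy
      -- From (kC + lCᵐ)Cⁿw = Cⁿ⁺¹(kw + lCᵐ⁻¹w).
      refine ⟨k • w + l • cyc K m lam ^ (m - 1) * w, ?_⟩
      have h1 : e K m lam .v1 * x = (e K m lam .v1 * x) * e K m lam .v1 := by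
        rw [h, add_mul, smul_mul_assoc, smul_mul_assoc, cyc_mul_e1, cyc_pow_mul_e1 (by omega)]
      rw [← mul_assoc, h1, mul_assoc, hw, h, add_mul, mul_add, smul_mul_assoc, smul_mul_assoc,
        mul_smul_comm, smul_mul_assoc, mul_smul_comm, ← mul_assoc, ← mul_assoc, ← mul_assoc,
        ← pow_succ', ← pow_add, ← pow_add, show m + n = n + 1 + (m - 1) by omega]
    · obtain ⟨u', hu⟩ := hu
      obtain ⟨v', hv⟩ := hv
      exact ⟨u' + v', by rw [mul_add, hu, hv, mul_add]⟩

/-- The arrows generate a nilpotent ideal. -/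
theorem arrowSpan_pow_eq_zero (hm : 2 ≤ m) (z : S K m lam)
    (hz : z ∈ arrowSpan K m lam ^ (4 * (m + 1) + 3)) : z = 0 := by
  have h1 : ∀ z ∈ arrowSpan K m lam ^ (4 * (m + 1)), e K m lam .v1 * z = 0 := by
    intro z hz
    obtain ⟨y, hy⟩ := e1_mul_arrowSpan_pow hm _ z hz
    rw [hy, cyc_pow_succ, zero_mul]
  have step (i : Vertex) (n : ℕ) (h : ∀ z ∈ arrowSpan K m lam ^ n, e K m lam i * z = 0) :
      ∀ z ∈ arrowSpan K m lam ^ (n + 1), e K m lam i * z = 0 := by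
    intro z hz
    rw [pow_succ] at hz
    refine Submodule.mul_induction_on hz (fun x hx y hy => ?_) (fun u v hu hv => ?_)
    · rw [← mul_assoc, h x hx, zero_mul]
    · rw [mul_add, hu, hv, add_zero]
  -- Every path reaches the vertex 1 after at most three arrows: 4 and 5 lead to 1, 3 leads to 4 and
  -- 5, and 2 and 6 lead to 3. This is the summand 3 of the exponent; `step` brings the shorter
  -- bounds to the same length.
  have h4 := e_mul_eq_zero_of_tgt (i := .v4) (fun a ha => by
    cases a <;> simp only [Arrow.src, reduceCtorEq] at ha; exact h1)
  have h5 := e_mul_eq_zero_of_tgt (i := .v5) (fun a ha => by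
    cases a <;> simp only [Arrow.src, reduceCtorEq] at ha; exact h1)
  have h3 := e_mul_eq_zero_of_tgt (i := .v3) (fun a ha => by
    cases a <;> simp only [Arrow.src, reduceCtorEq] at ha
    · exact h4
    · exact h5)
  have h2 := e_mul_eq_zero_of_tgt (i := .v2) (fun a ha => by
    cases a <;> simp only [Arrow.src, reduceCtorEq] at ha; exact h3)
  have h6 := e_mul_eq_zero_of_tgt (i := .v6) (fun a ha => by
    cases a <;> simp only [Arrow.src, reduceCtorEq] at ha; exact h3)
  have h1' := step _ _ (step _ _ (step _ _ h1)) z hz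
  have h4' := step _ _ (step _ _ h4) z hz
  have h5' := step _ _ (step _ _ h5) z hz
  have h3' := step _ _ h3 z hz
  rw [← one_mul z, ← sum_e, sum_vertex]
  simp only [add_mul, h1', h2 z hz, h3', h4', h5', h6 z hz, add_zero]

variable (K m lam) in
/-- The ideal generated by the arrows, as a subspace. -/
noncomputable def radical : Submodule K (S K m lam) :=
  LinearMap.ker (augmentation K m lam).toLinearMap

lemma mem_radical {x : S K m lam} :
    x ∈ radical K m lam ↔ augmentation K m lam x = 0 := Iff.rfl

theorem radical_pow_eq_bot (hm : 2 ≤ m) :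
    radical K m lam ^ (4 * (m + 1) + 3) = ⊥ := by
  have h1 : radical K m lam ≤ arrowSpan K m lam * ⊤ :=
    fun x hx => mem_arrowSpan_mul_top hx
  rw [eq_bot_iff]
  refine (pow_le_pow_left' h1 _).trans ((arrowSpan_mul_top_pow_le _).trans ?_)
  rw [Submodule.mul_le]
  intro x hx y _
  rw [arrowSpan_pow_eq_zero hm x hx, zero_mul]
  exact zero_mem _

lemma isNilpotent_of_mem_radical (hm : 2 ≤ m) {x : S K m lam}
    (hx : x ∈ radical K m lam) : IsNilpotent x := by
  refine ⟨4 * (m + 1) + 3, ?_⟩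
  have h := Submodule.pow_mem_pow _ hx (4 * (m + 1) + 3)
  rwa [radical_pow_eq_bot hm, Submodule.mem_bot] at h

end Augmentation

end HigherSpherical

namespace HigherSpherical

/-! ### An explicit right module modelled on e₃S -/

section Representation

variable (K : Type u) [Field K] (m : ℕ) (lam : K)

/-- The space which carries a right module isomorphic to `e₃S`. The basis vectors with index
`(i, k)` span the space at the vertex `i`. -/
abbrev Rep : Type u := Vertex × ℕ →₀ K

variable {K} in
/-- The action of an arrow on the basis vectors at its source. -/
noncomputable def actArrow : Arrow → Vertex → ℕ → Rep K
  -- The vector (3, 0) plays the role of e₃. For k < m, with c = γσαβ, the vectors (3, k), (4, k),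
  -- (1, k), (2, k), (6, k), (5, k) stand for cᵏ followed by nothing, γ, γσ, γσα, γσρ, ν. Moreover
  -- (3, m) stands for cᵐ, and (1, m) for νδ - γσ, so that the second relation of the algebra
  -- dictates the value λ(2, m - 1) of α on it. The remaining vectors are killed by all arrows.
  | .α, .v1, k => if k < m then .single (.v2, k) 1 else
      if k = m then .single (.v2, m - 1) lam else 0
  | .β, .v2, k => if k < m then .single (.v3, k + 1) 1 else 0
  | .γ, .v3, k => if k < m then .single (.v4, k) 1 else 0
  | .σ, .v4, k => if k < m then .single (.v1, k) 1 else 0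
  | .ρ, .v1, k => if k < m then .single (.v6, k) 1 else 0
  | .ω, .v6, k => if k = 0 then .single (.v3, 1) 1 + .single (.v3, m) lam else
      if k < m then .single (.v3, k + 1) 1 else 0
  | .ν, .v3, k => if k < m then .single (.v5, k) 1 else 0
  | .δ, .v5, k => if k = 0 then .single (.v1, 0) 1 + .single (.v1, m) 1 else
      if k < m then .single (.v1, k) 1 else 0
  | _, _, _ => 0

variable {K} in
/-- The endomorphism by which an arrow acts. -/
noncomputable def opArrow (a : Arrow) : Module.End K (Rep K) :=
  Finsupp.linearCombination K fun p => actArrow m lam a p.1 p.2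

/-- The endomorphism by which a trivial path acts. -/
noncomputable def opVertex (i : Vertex) : Module.End K (Rep K) :=
  Finsupp.linearCombination K fun p => if p.1 = i then Finsupp.single p 1 else 0

variable {K m lam}

lemma opArrow_single (a : Arrow) (i : Vertex) (k : ℕ) (t : K) :
    opArrow m lam a (.single (i, k) t) = t • actArrow m lam a i k := by
  simp [opArrow]

lemma opVertex_single (i j : Vertex) (k : ℕ) (t : K) :
    opVertex K i (.single (j, k) t) = if j = i then Finsupp.single (j, k) t else 0 := by
  simp [opVertex]

/-- Each cycle of length four occurring in a power acts on the vectors at its vertex as a truncated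
shift, with M = m at 1, 2, 4 and M = m + 1 at 3. The powers in the relations thereby get a closed
form. -/
lemma pow_apply_of_shift {f : Module.End K (Rep K)} {i : Vertex} {M : ℕ}
    (h : ∀ k, f (.single (i, k) 1) = if k + 1 < M then .single (i, k + 1) 1 else 0) (n k : ℕ) :
    (f ^ (n + 1)) (.single (i, k) 1) =
      if k + (n + 1) < M then .single (i, k + (n + 1)) 1 else 0 := by
  induction n generalizing k with
  | zero => simpa using h k
  | succ n ih =>
    rw [pow_succ, Module.End.mul_apply, h]
    split_ifs with h1 h2 h2
    · rw [ih, if_pos (by omega)]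
      congr 2; omega
    · rw [ih, if_neg (by omega)]
    · omega
    · rw [map_zero]

lemma pow_succ_apply_eq_zero {f : Module.End K (Rep K)} {v : Rep K} (h : f v = 0) (n : ℕ) :
    (f ^ (n + 1)) v = 0 := by
  rw [pow_succ, Module.End.mul_apply, h, map_zero]

/-- The homomorphism from the free algebra which extends the action of the generators. -/
noncomputable def freeAct (K : Type u) [Field K] (m : ℕ) (lam : K) :
    FreeAlg K →ₐ[K] (Module.End K (Rep K))ᵐᵒᵖ :=
  FreeAlgebra.lift K (Sum.elim (fun i => .op (opVertex K i)) fun a => .op (opArrow m lam a))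

lemma freeAct_vtx (i : Vertex) : freeAct K m lam (vtx K i) = .op (opVertex K i) := by
  simp [freeAct, vtx]

lemma freeAct_arr (a : Arrow) : freeAct K m lam (arr K a) = .op (opArrow m lam a) := by
  simp [freeAct, arr]

lemma end_op_ext {f g : (Module.End K (Rep K))ᵐᵒᵖ}
    (h : ∀ i k, f.unop (.single (i, k) 1) = g.unop (.single (i, k) 1)) : f = g := by
  apply MulOpposite.unop_injective
  ext ⟨i, k⟩ : 2
  simpa using h i k

variable {n : ℕ}

local notation "A2" => opArrow (n + 2) lam Arrow.α
local notation "B2" => opArrow (n + 2) lam Arrow.β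
local notation "G2" => opArrow (n + 2) lam Arrow.γ
local notation "S2" => opArrow (n + 2) lam Arrow.σ
local notation "R2" => opArrow (n + 2) lam Arrow.ρ
local notation "O2" => opArrow (n + 2) lam Arrow.ω
local notation "N2" => opArrow (n + 2) lam Arrow.ν
local notation "D2" => opArrow (n + 2) lam Arrow.δ

lemma opArrow_single_of_ne {a : Arrow} {i : Vertex} (h : i ≠ a.src) (k : ℕ) (t : K) :
    opArrow m lam a (.single (i, k) t) = 0 := by
  rw [opArrow_single]
  cases a <;> cases i <;> simp [Arrow.src] at h <;> simp [actArrow]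

section Actions

variable {k : ℕ} (t : K)

lemma alpha_of_lt (h : k < n + 2) : A2 (.single (.v1, k) t) = .single (.v2, k) t := by
  simp [opArrow_single, actArrow, h]

lemma alpha_of_eq (h : k = n + 2) :
    A2 (.single (.v1, k) t) = .single (.v2, n + 1) (t * lam) := by
  simp [opArrow_single, actArrow, h]

lemma alpha_of_gt (h : n + 2 < k) : A2 (.single (.v1, k) t) = 0 := by
  simp [opArrow_single, actArrow, h.not_gt, h.ne']

lemma beta_of_lt (h : k < n + 2) : B2 (.single (.v2, k) t) = .single (.v3, k + 1) t := by
  simp [opArrow_single, actArrow, h]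

lemma beta_of_ge (h : n + 2 ≤ k) : B2 (.single (.v2, k) t) = 0 := by
  simp [opArrow_single, actArrow, h.not_gt]

lemma gamma_of_lt (h : k < n + 2) : G2 (.single (.v3, k) t) = .single (.v4, k) t := by
  simp [opArrow_single, actArrow, h]

lemma gamma_of_ge (h : n + 2 ≤ k) : G2 (.single (.v3, k) t) = 0 := by
  simp [opArrow_single, actArrow, h.not_gt]

lemma sigma_of_lt (h : k < n + 2) : S2 (.single (.v4, k) t) = .single (.v1, k) t := by
  simp [opArrow_single, actArrow, h]

lemma sigma_of_ge (h : n + 2 ≤ k) : S2 (.single (.v4, k) t) = 0 := by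
  simp [opArrow_single, actArrow, h.not_gt]

lemma rho_of_lt (h : k < n + 2) : R2 (.single (.v1, k) t) = .single (.v6, k) t := by
  simp [opArrow_single, actArrow, h]

lemma rho_of_ge (h : n + 2 ≤ k) : R2 (.single (.v1, k) t) = 0 := by
  simp [opArrow_single, actArrow, h.not_gt]

lemma omega_of_eq (h : k = 0) : O2 (.single (.v6, k) t) =
    .single (.v3, 1) t + .single (.v3, n + 2) (t * lam) := by
  simp [opArrow_single, actArrow, h]

lemma omega_of_lt (h0 : 0 < k) (h : k < n + 2) :
    O2 (.single (.v6, k) t) = .single (.v3, k + 1) t := by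
  simp [opArrow_single, actArrow, h, h0.ne']

lemma omega_of_ge (h : n + 2 ≤ k) : O2 (.single (.v6, k) t) = 0 := by
  simp [opArrow_single, actArrow, h.not_gt, show k ≠ 0 by omega]

lemma nu_of_lt (h : k < n + 2) : N2 (.single (.v3, k) t) = .single (.v5, k) t := by
  simp [opArrow_single, actArrow, h]

lemma nu_of_ge (h : n + 2 ≤ k) : N2 (.single (.v3, k) t) = 0 := by
  simp [opArrow_single, actArrow, h.not_gt]

lemma delta_of_eq (h : k = 0) : D2 (.single (.v5, k) t) =
    .single (.v1, 0) t + .single (.v1, n + 2) t := by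
  simp [opArrow_single, actArrow, h]

lemma delta_of_lt (h0 : 0 < k) (h : k < n + 2) :
    D2 (.single (.v5, k) t) = .single (.v1, k) t := by
  simp [opArrow_single, actArrow, h, h0.ne']

lemma delta_of_ge (h : n + 2 ≤ k) : D2 (.single (.v5, k) t) = 0 := by
  simp [opArrow_single, actArrow, h.not_gt, show k ≠ 0 by omega]

end Actions

lemma cyc1_apply (k : ℕ) : (S2 * (G2 * (B2 * A2))) (.single (.v1, k) 1) =
    if k + 1 < n + 2 then .single (.v1, k + 1) 1 else 0 := by
  simp only [Module.End.mul_apply]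
  rcases (by omega : k < n + 1 ∨ k = n + 1 ∨ k = n + 2 ∨ n + 2 < k) with h | h | h | h <;>
  simp (disch := omega) only [alpha_of_lt, alpha_of_eq, alpha_of_gt, beta_of_lt, gamma_of_lt,
    gamma_of_ge, sigma_of_lt, if_pos, if_neg, map_zero]

lemma cyc2_apply (k : ℕ) : (A2 * (S2 * (G2 * B2))) (.single (.v2, k) 1) =
    if k + 1 < n + 2 then .single (.v2, k + 1) 1 else 0 := by
  simp only [Module.End.mul_apply]
  rcases (by omega : k < n + 1 ∨ k = n + 1 ∨ n + 2 ≤ k) with h | h | h <;>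
  simp (disch := omega) only [alpha_of_lt, beta_of_lt, beta_of_ge, gamma_of_lt,
    gamma_of_ge, sigma_of_lt, if_pos, if_neg, map_zero]

lemma cyc3_apply (k : ℕ) : (B2 * (A2 * (S2 * G2))) (.single (.v3, k) 1) =
    if k + 1 < n + 3 then .single (.v3, k + 1) 1 else 0 := by
  simp only [Module.End.mul_apply]
  rcases (by omega : k < n + 2 ∨ n + 2 ≤ k) with h | h <;>
  simp (disch := omega) only [alpha_of_lt, beta_of_lt, gamma_of_lt,
    gamma_of_ge, sigma_of_lt, if_pos, if_neg, map_zero]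

lemma cyc4_apply (k : ℕ) : (G2 * (B2 * (A2 * S2))) (.single (.v4, k) 1) =
    if k + 1 < n + 2 then .single (.v4, k + 1) 1 else 0 := by
  simp only [Module.End.mul_apply]
  rcases (by omega : k < n + 1 ∨ k = n + 1 ∨ n + 2 ≤ k) with h | h | h <;>
  simp (disch := omega) only [alpha_of_lt, beta_of_lt, gamma_of_lt,
    gamma_of_ge, sigma_of_lt, sigma_of_ge, if_pos, if_neg, map_zero]

-- Both sides of a relation are compared on basis vectors: away from the source of the relation
-- everything vanishes, and at the source the paths are evaluated arrow by arrow.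
set_option linter.unusedSimpArgs false in
lemma freeAct_rel {x y : FreeAlg K} (h : Rel K (n + 2) lam x y) :
    freeAct K (n + 2) lam x = freeAct K (n + 2) lam y := by
  have hn : n + 2 - 1 = n + 1 := rfl
  -- With m = n + 2, the indices are separated at 0, m - 1 and m, where the formula for an arrow or
  -- the truncation of a shift changes.
  have hk (k : ℕ) : k = 0 ∨ 0 < k ∧ k < n + 1 ∨ 0 < k ∧ k = n + 1 ∨ k = n + 2 ∨
    n + 2 < k := by omega
  cases h with
  | vtx_mul_vtx i j =>
    rw [map_mul, freeAct_vtx, freeAct_vtx]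
    refine end_op_ext fun l k => ?_
    rw [MulOpposite.unop_mul, Module.End.mul_apply, MulOpposite.unop_op, MulOpposite.unop_op,
      opVertex_single]
    split_ifs with h1 h2 h2
    · rw [freeAct_vtx, MulOpposite.unop_op, ← h2]
    · rw [opVertex_single, if_neg (fun h => h2 (h1.symm.trans h)), map_zero]
      rfl
    · rw [freeAct_vtx, MulOpposite.unop_op, opVertex_single, if_neg h1, map_zero]
    · simp
  | sum_vtx =>
    rw [map_sum, map_one]
    refine end_op_ext fun l k => ?_
    simp [freeAct_vtx, opVertex_single]
  | src_mul a =>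
    rw [map_mul, freeAct_vtx, freeAct_arr]
    refine end_op_ext fun l k => ?_
    rw [MulOpposite.unop_mul, Module.End.mul_apply, MulOpposite.unop_op, MulOpposite.unop_op,
      opVertex_single]
    split_ifs with h
    · rfl
    · rw [opArrow_single_of_ne h, map_zero]
  | mul_tgt a =>
    rw [map_mul, freeAct_vtx, freeAct_arr]
    refine end_op_ext fun l k => ?_
    rw [MulOpposite.unop_mul, Module.End.mul_apply, MulOpposite.unop_op, MulOpposite.unop_op,
      opArrow_single]
    cases a <;> cases l <;> simp only [actArrow] <;> (try split_ifs) <;>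
      simp [opVertex_single, Arrow.tgt]
  | r1 =>
    simp only [map_mul, map_add, map_smul, map_pow, map_zero, freeAct_arr]
    refine end_op_ext fun i k => ?_
    simp only [MulOpposite.unop_mul, MulOpposite.unop_add, MulOpposite.unop_smul,
      MulOpposite.unop_pow, MulOpposite.unop_op, MulOpposite.unop_zero, hn]
    by_cases hi : i = .v2
    swap
    · simp only [Module.End.mul_apply, LinearMap.add_apply, LinearMap.smul_apply,
        LinearMap.zero_apply, opArrow_single_of_ne (a := .β) hi, map_zero]
      rw [pow_succ_apply_eq_zero (by simp only [Module.End.mul_apply,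
        opArrow_single_of_ne (a := .β) hi, map_zero])]
      simp only [map_zero, smul_zero, add_zero]
    subst hi
    simp only [LinearMap.add_apply, LinearMap.smul_apply, LinearMap.zero_apply,
      Module.End.mul_apply _ (_ ^ _), pow_apply_of_shift cyc2_apply, Module.End.mul_apply]
    rcases hk k with rfl | h | h | h | h <;>
      simp (disch := omega) only [zero_add, alpha_of_lt, alpha_of_eq,
        alpha_of_gt, beta_of_lt, beta_of_ge, gamma_of_lt, gamma_of_ge, sigma_of_lt, sigma_of_ge,
        rho_of_lt, rho_of_ge, omega_of_eq, omega_of_lt, omega_of_ge, nu_of_lt, nu_of_ge,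
        delta_of_eq, delta_of_lt, delta_of_ge, if_pos, if_neg, map_zero, map_add, smul_zero,
        add_zero, Finsupp.smul_single, smul_eq_mul, mul_one, one_mul]
  | r2 =>
    simp only [map_mul, map_add, map_smul, map_pow, map_zero, freeAct_arr]
    refine end_op_ext fun i k => ?_
    simp only [MulOpposite.unop_mul, MulOpposite.unop_add, MulOpposite.unop_smul,
      MulOpposite.unop_pow, MulOpposite.unop_op, MulOpposite.unop_zero, hn]
    by_cases hi : i = .v3
    swap
    · simp only [Module.End.mul_apply, LinearMap.add_apply, LinearMap.smul_apply,
        LinearMap.zero_apply, opArrow_single_of_ne (a := .γ) hi, opArrow_single_of_ne (a := .ν) hi, map_zero]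
      rw [pow_succ_apply_eq_zero (by simp only [Module.End.mul_apply,
        opArrow_single_of_ne (a := .γ) hi, map_zero])]
      simp only [map_zero, smul_zero, add_zero]
    subst hi
    simp only [LinearMap.add_apply, LinearMap.smul_apply, LinearMap.zero_apply,
      Module.End.mul_apply _ (_ ^ _), pow_apply_of_shift cyc3_apply, Module.End.mul_apply]
    -- At the vertex 3 the shift is truncated one step later, so m - 1 turns survive for k = 1 as
    -- well as for k = 0; γ then kills the result (3, m) for k = 1.
    rcases (by omega : k = 0 ∨ 0 < k ∧ k < n + 2 ∧ k + (n + 1) < n + 3 ∨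
      k < n + 2 ∧ ¬ k + (n + 1) < n + 3 ∨ k = n + 2 ∨ n + 2 < k) with rfl | h | h | h | h <;>
      simp (disch := omega) only [zero_add, alpha_of_lt, alpha_of_eq,
        alpha_of_gt, beta_of_lt, beta_of_ge, gamma_of_lt, gamma_of_ge, sigma_of_lt, sigma_of_ge,
        rho_of_lt, rho_of_ge, omega_of_eq, omega_of_lt, omega_of_ge, nu_of_lt, nu_of_ge,
        delta_of_eq, delta_of_lt, delta_of_ge, if_pos, if_neg, map_zero, map_add, smul_zero,
        add_zero, Finsupp.smul_single, smul_eq_mul, mul_one, one_mul]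
  | r3 =>
    simp only [map_mul, map_add, map_smul, map_pow, map_zero, freeAct_arr]
    refine end_op_ext fun i k => ?_
    simp only [MulOpposite.unop_mul, MulOpposite.unop_add, MulOpposite.unop_smul,
      MulOpposite.unop_pow, MulOpposite.unop_op, MulOpposite.unop_zero, hn]
    by_cases hi : i = .v4
    swap
    · simp only [Module.End.mul_apply, LinearMap.add_apply, LinearMap.smul_apply,
        LinearMap.zero_apply, opArrow_single_of_ne (a := .σ) hi, map_zero]
      rw [pow_succ_apply_eq_zero (by simp only [Module.End.mul_apply,
        opArrow_single_of_ne (a := .σ) hi, map_zero])]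
      simp only [map_zero, smul_zero, add_zero]
    subst hi
    simp only [LinearMap.add_apply, LinearMap.smul_apply, LinearMap.zero_apply,
      Module.End.mul_apply _ (_ ^ _), pow_apply_of_shift cyc4_apply, Module.End.mul_apply]
    rcases hk k with rfl | h | h | h | h <;>
      simp (disch := omega) only [zero_add, alpha_of_lt, alpha_of_eq,
        alpha_of_gt, beta_of_lt, beta_of_ge, gamma_of_lt, gamma_of_ge, sigma_of_lt, sigma_of_ge,
        rho_of_lt, rho_of_ge, omega_of_eq, omega_of_lt, omega_of_ge, nu_of_lt, nu_of_ge,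
        delta_of_eq, delta_of_lt, delta_of_ge, if_pos, if_neg, map_zero, map_add, smul_zero,
        add_zero, Finsupp.smul_single, smul_eq_mul, mul_one, one_mul]
  | r4 =>
    simp only [map_mul, map_add, map_smul, map_pow, map_zero, freeAct_arr]
    refine end_op_ext fun i k => ?_
    simp only [MulOpposite.unop_mul, MulOpposite.unop_add, MulOpposite.unop_smul,
      MulOpposite.unop_pow, MulOpposite.unop_op, MulOpposite.unop_zero, hn]
    by_cases hi : i = .v1
    swap
    · simp only [Module.End.mul_apply, LinearMap.add_apply, LinearMap.smul_apply,
        LinearMap.zero_apply, opArrow_single_of_ne (a := .α) hi, opArrow_single_of_ne (a := .ρ) hi, map_zero]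
      rw [pow_succ_apply_eq_zero (by simp only [Module.End.mul_apply,
        opArrow_single_of_ne (a := .α) hi, map_zero])]
      simp only [map_zero, smul_zero, add_zero]
    subst hi
    simp only [LinearMap.add_apply, LinearMap.smul_apply, LinearMap.zero_apply,
      Module.End.mul_apply _ (_ ^ _), pow_apply_of_shift cyc1_apply, Module.End.mul_apply]
    rcases hk k with rfl | h | h | h | h <;>
      simp (disch := omega) only [zero_add, alpha_of_lt, alpha_of_eq,
        alpha_of_gt, beta_of_lt, beta_of_ge, gamma_of_lt, gamma_of_ge, sigma_of_lt, sigma_of_ge,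
        rho_of_lt, rho_of_ge, omega_of_eq, omega_of_lt, omega_of_ge, nu_of_lt, nu_of_ge,
        delta_of_eq, delta_of_lt, delta_of_ge, if_pos, if_neg, map_zero, map_add, smul_zero,
        add_zero, Finsupp.smul_single, smul_eq_mul, mul_one, one_mul]
  | r5 =>
    simp only [map_mul, map_add, map_smul, map_pow, map_zero, freeAct_arr]
    refine end_op_ext fun i k => ?_
    simp only [MulOpposite.unop_mul, MulOpposite.unop_add, MulOpposite.unop_smul,
      MulOpposite.unop_pow, MulOpposite.unop_op, MulOpposite.unop_zero, hn]
    by_cases hi : i = .v1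
    swap
    · simp only [Module.End.mul_apply, LinearMap.add_apply, LinearMap.smul_apply,
        LinearMap.zero_apply, opArrow_single_of_ne (a := .α) hi, opArrow_single_of_ne (a := .ρ) hi, map_zero]
    subst hi
    simp only [LinearMap.add_apply, LinearMap.smul_apply, LinearMap.zero_apply,
      Module.End.mul_apply _ (_ ^ _), Module.End.mul_apply]
    rcases hk k with rfl | h | h | h | h <;>
      simp (disch := omega) only [zero_add, alpha_of_lt, alpha_of_eq,
        alpha_of_gt, beta_of_lt, beta_of_ge, gamma_of_lt, gamma_of_ge, sigma_of_lt, sigma_of_ge,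
        rho_of_lt, rho_of_ge, omega_of_eq, omega_of_lt, omega_of_ge, nu_of_lt, nu_of_ge,
        delta_of_eq, delta_of_lt, delta_of_ge, if_pos, if_neg, map_zero, map_add, smul_zero,
        add_zero, Finsupp.smul_single, smul_eq_mul, mul_one, one_mul]
  | r6 =>
    simp only [map_mul, map_add, map_smul, map_pow, map_zero, freeAct_arr]
    refine end_op_ext fun i k => ?_
    simp only [MulOpposite.unop_mul, MulOpposite.unop_add, MulOpposite.unop_smul,
      MulOpposite.unop_pow, MulOpposite.unop_op, MulOpposite.unop_zero, hn]
    by_cases hi : i = .v5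
    swap
    · simp only [Module.End.mul_apply, LinearMap.add_apply, LinearMap.smul_apply,
        LinearMap.zero_apply, opArrow_single_of_ne (a := .δ) hi, map_zero]
    subst hi
    simp only [LinearMap.add_apply, LinearMap.smul_apply, LinearMap.zero_apply,
      Module.End.mul_apply _ (_ ^ _), Module.End.mul_apply]
    rcases hk k with rfl | h | h | h | h <;>
      simp (disch := omega) only [zero_add, alpha_of_lt, alpha_of_eq,
        alpha_of_gt, beta_of_lt, beta_of_ge, gamma_of_lt, gamma_of_ge, sigma_of_lt, sigma_of_ge,
        rho_of_lt, rho_of_ge, omega_of_eq, omega_of_lt, omega_of_ge, nu_of_lt, nu_of_ge,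
        delta_of_eq, delta_of_lt, delta_of_ge, if_pos, if_neg, map_zero, map_add, smul_zero,
        add_zero, Finsupp.smul_single, smul_eq_mul, mul_one, one_mul]
  | r7 =>
    simp only [map_mul, map_add, map_smul, map_pow, map_zero, freeAct_arr]
    refine end_op_ext fun i k => ?_
    simp only [MulOpposite.unop_mul, MulOpposite.unop_add, MulOpposite.unop_smul,
      MulOpposite.unop_pow, MulOpposite.unop_op, MulOpposite.unop_zero, hn]
    by_cases hi : i = .v6
    swap
    · simp only [Module.End.mul_apply, LinearMap.add_apply, LinearMap.smul_apply,
        LinearMap.zero_apply, opArrow_single_of_ne (a := .ω) hi, map_zero]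
    subst hi
    simp only [LinearMap.add_apply, LinearMap.smul_apply, LinearMap.zero_apply,
      Module.End.mul_apply _ (_ ^ _), Module.End.mul_apply]
    rcases hk k with rfl | h | h | h | h <;>
      simp (disch := omega) only [zero_add, alpha_of_lt, alpha_of_eq,
        alpha_of_gt, beta_of_lt, beta_of_ge, gamma_of_lt, gamma_of_ge, sigma_of_lt, sigma_of_ge,
        rho_of_lt, rho_of_ge, omega_of_eq, omega_of_lt, omega_of_ge, nu_of_lt, nu_of_ge,
        delta_of_eq, delta_of_lt, delta_of_ge, if_pos, if_neg, map_zero, map_add, smul_zero,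
        add_zero, Finsupp.smul_single, smul_eq_mul, mul_one, one_mul]
  | r8 =>
    simp only [map_mul, map_add, map_smul, map_pow, map_zero, freeAct_arr]
    refine end_op_ext fun i k => ?_
    simp only [MulOpposite.unop_mul, MulOpposite.unop_add, MulOpposite.unop_smul,
      MulOpposite.unop_pow, MulOpposite.unop_op, MulOpposite.unop_zero, hn]
    by_cases hi : i = .v3
    swap
    · simp only [Module.End.mul_apply, LinearMap.add_apply, LinearMap.smul_apply,
        LinearMap.zero_apply, opArrow_single_of_ne (a := .γ) hi, opArrow_single_of_ne (a := .ν) hi, map_zero]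
    subst hi
    simp only [LinearMap.add_apply, LinearMap.smul_apply, LinearMap.zero_apply,
      Module.End.mul_apply _ (_ ^ _), Module.End.mul_apply]
    rcases hk k with rfl | h | h | h | h <;>
      simp (disch := omega) only [zero_add, alpha_of_lt, alpha_of_eq,
        alpha_of_gt, beta_of_lt, beta_of_ge, gamma_of_lt, gamma_of_ge, sigma_of_lt, sigma_of_ge,
        rho_of_lt, rho_of_ge, omega_of_eq, omega_of_lt, omega_of_ge, nu_of_lt, nu_of_ge,
        delta_of_eq, delta_of_lt, delta_of_ge, if_pos, if_neg, map_zero, map_add, smul_zero,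
        add_zero, Finsupp.smul_single, smul_eq_mul, mul_one, one_mul]
  | r9 =>
    simp only [map_mul, map_add, map_smul, map_pow, map_zero, freeAct_arr]
    refine end_op_ext fun i k => ?_
    simp only [MulOpposite.unop_mul, MulOpposite.unop_add, MulOpposite.unop_smul,
      MulOpposite.unop_pow, MulOpposite.unop_op, MulOpposite.unop_zero, hn]
    by_cases hi : i = .v1
    swap
    · simp only [Module.End.mul_apply, LinearMap.add_apply, LinearMap.smul_apply,
        LinearMap.zero_apply, opArrow_single_of_ne (a := .α) hi, map_zero]
      rw [pow_succ_apply_eq_zero (by simp only [Module.End.mul_apply,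
        opArrow_single_of_ne (a := .α) hi, map_zero])]
      simp only [map_zero, smul_zero, add_zero]
    subst hi
    simp only [LinearMap.add_apply, LinearMap.smul_apply, LinearMap.zero_apply,
      Module.End.mul_apply _ (_ ^ _), pow_apply_of_shift cyc1_apply, Module.End.mul_apply]
    rcases hk k with rfl | h | h | h | h <;>
      simp (disch := omega) only [zero_add, alpha_of_lt, alpha_of_eq,
        alpha_of_gt, beta_of_lt, beta_of_ge, gamma_of_lt, gamma_of_ge, sigma_of_lt, sigma_of_ge,
        rho_of_lt, rho_of_ge, omega_of_eq, omega_of_lt, omega_of_ge, nu_of_lt, nu_of_ge,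
        delta_of_eq, delta_of_lt, delta_of_ge, if_pos, if_neg, map_zero, map_add, smul_zero,
        add_zero, Finsupp.smul_single, smul_eq_mul, mul_one, one_mul]
  | r10 =>
    simp only [map_mul, map_add, map_smul, map_pow, map_zero, freeAct_arr]
    refine end_op_ext fun i k => ?_
    simp only [MulOpposite.unop_mul, MulOpposite.unop_add, MulOpposite.unop_smul,
      MulOpposite.unop_pow, MulOpposite.unop_op, MulOpposite.unop_zero, hn]
    by_cases hi : i = .v3
    swap
    · simp only [Module.End.mul_apply, LinearMap.add_apply, LinearMap.smul_apply,
        LinearMap.zero_apply, opArrow_single_of_ne (a := .γ) hi, map_zero]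
      rw [pow_succ_apply_eq_zero (by simp only [Module.End.mul_apply,
        opArrow_single_of_ne (a := .γ) hi, map_zero])]
      simp only [map_zero, smul_zero, add_zero]
    subst hi
    simp only [LinearMap.add_apply, LinearMap.smul_apply, LinearMap.zero_apply,
      Module.End.mul_apply _ (_ ^ _), pow_apply_of_shift cyc3_apply, Module.End.mul_apply]
    rcases hk k with rfl | h | h | h | h <;>
      simp (disch := omega) only [zero_add, alpha_of_lt, alpha_of_eq,
        alpha_of_gt, beta_of_lt, beta_of_ge, gamma_of_lt, gamma_of_ge, sigma_of_lt, sigma_of_ge,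
        rho_of_lt, rho_of_ge, omega_of_eq, omega_of_lt, omega_of_ge, nu_of_lt, nu_of_ge,
        delta_of_eq, delta_of_lt, delta_of_ge, if_pos, if_neg, map_zero, map_add, smul_zero,
        add_zero, Finsupp.smul_single, smul_eq_mul, mul_one, one_mul]

/-- The right module isomorphic to `e₃S`, as a homomorphism to the opposite of an endomorphism
algebra. -/
noncomputable def repHom (K : Type u) [Field K] (n : ℕ) (lam : K) :
    S K (n + 2) lam →ₐ[K] (Module.End K (Rep K))ᵐᵒᵖ :=
  RingQuot.liftAlgHom K ⟨freeAct K (n + 2) lam, fun _ _ h => freeAct_rel h⟩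

/-- The action of an element of the higher spherical algebra. -/
noncomputable def act (x : S K (n + 2) lam) : Module.End K (Rep K) := (repHom K n lam x).unop

lemma act_mul (x y : S K (n + 2) lam) (v : Rep K) : act (x * y) v = act y (act x v) := by
  simp [act]

lemma act_arrow (a : Arrow) : act (arrow K (n + 2) lam a) = opArrow (n + 2) lam a := by
  simp [act, repHom, arrow, freeAct_arr]

lemma act_e (i : Vertex) : act (e K (n + 2) lam i) = opVertex K i := by
  simp [act, repHom, e, freeAct_vtx]

lemma act_pow (x : S K (n + 2) lam) (k : ℕ) : act (x ^ k) = act x ^ k := by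
  simp [act]

lemma act_cyc : act (cyc K (n + 2) lam) = S2 * (G2 * (B2 * A2)) := by
  refine LinearMap.ext fun v => ?_
  simp only [cyc, act_mul, act_arrow, Module.End.mul_apply]

lemma act_cyc_pow {j : ℕ} (h : j < n + 2) :
    act (cyc K (n + 2) lam ^ j) (.single (.v1, 0) 1) = .single (.v1, j) 1 := by
  rcases j with _ | j
  · simp [act]
  · rw [act_pow, act_cyc, pow_apply_of_shift cyc1_apply, if_pos (by omega), zero_add]

/-- The cycle takes (1, m) through λ(2, m - 1) and λ(3, m), where γ gives 0. Hence νδ and γσ have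
the same effect on (3, 0) once they are followed by C. -/
lemma act_cyc_pow_top {j : ℕ} (h : 0 < j) :
    act (cyc K (n + 2) lam ^ j) (.single (.v1, n + 2) 1) = 0 := by
  obtain ⟨j, rfl⟩ := Nat.exists_eq_succ_of_ne_zero h.ne'
  rw [act_pow, act_cyc, Nat.succ_eq_add_one, pow_apply_of_shift cyc1_apply, if_neg (by omega)]

end Representation

/-! ### Injectivity of left multiplication by γ and by ν -/

section Injectivity

variable {K : Type u} [Field K] {n : ℕ} {lam : K}

lemma apply_eq_sum_range {N : Type*} [AddCommGroup N] [Module K N] (f : Polynomial K →ₗ[K] N)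
    {M : ℕ} (h : ∀ j, M ≤ j → f (Polynomial.X ^ j) = 0) (p : Polynomial K) :
    f p = ∑ j ∈ Finset.range M, p.coeff j • f (Polynomial.X ^ j) := by
  have h1 : f p = ∑ j ∈ Finset.range (p.natDegree + 1 + M),
      p.coeff j • f (Polynomial.X ^ j) := by
    conv_lhs => rw [p.as_sum_range' (p.natDegree + 1 + M) (by omega)]
    rw [map_sum]
    refine Finset.sum_congr rfl fun j _ => ?_
    rw [← map_smul, Polynomial.X_pow_eq_monomial, Polynomial.smul_monomial, smul_eq_mul, mul_one]
  rw [h1]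
  symm
  refine Finset.sum_subset (Finset.range_mono (by omega)) fun j _ hj => ?_
  rw [h j (by simpa using hj), smul_zero]

/-- Linear independence of a family of basis vectors, the first of which is modified. -/
lemma coeff_eq_zero_of_sum_eq_zero {ι : Type*} [DecidableEq ι] {M : ℕ} {a : ℕ → K} {v : ℕ → ι →₀ K}
    {b : ℕ → ι} (hb : Function.Injective b) {q : ι} {t : K} (hq : q ≠ b 0)
    (h0 : v 0 = .single (b 0) 1 + .single q t) (hv : ∀ j, 0 < j → j < M → v j = .single (b j) 1)
    (h : ∑ j ∈ Finset.range M, a j • v j = 0) (j : ℕ) (hj : j < M) : a j = 0 := by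
  obtain ⟨M, rfl⟩ := Nat.exists_eq_succ_of_ne_zero (by omega : M ≠ 0)
  rw [Finset.sum_range_succ', h0] at h
  have hs (l : ℕ) : (∑ k ∈ Finset.range M, a (k + 1) • v (k + 1)) (b l) =
      ∑ k ∈ Finset.range M, if k + 1 = l then a (k + 1) else 0 := by
    rw [Finsupp.finsetSum_apply]
    refine Finset.sum_congr rfl fun k hk => ?_
    rw [Finset.mem_range] at hk
    rw [hv _ (by omega) (by omega), Finsupp.smul_apply, Finsupp.single_apply]
    simp only [hb.eq_iff, smul_eq_mul, mul_ite, mul_one, mul_zero]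
  -- The coefficient at `b 0` has to be read off before the others: `q` differs from `b 0` but may
  -- coincide with a later `b j`.
  have ha0 : a 0 = 0 := by
    have := DFunLike.congr_fun h (b 0)
    rw [Finsupp.add_apply, hs] at this
    simpa [Finsupp.single_apply, hq] using this
  rcases j with _ | j
  · exact ha0
  · have := DFunLike.congr_fun h (b (j + 1))
    rw [ha0, zero_smul, add_zero, hs] at this
    simp only [add_left_inj, Finset.sum_ite_eq', Finset.mem_range] at this
    rwa [if_pos (by omega)] at this

local notation "C1" => cyc K (n + 2) lam

/-- A criterion for left multiplication by `z` to be injective on the products of `u`, a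
polynomial in `αβγσ` and `w`. -/
lemma mul_aeval_mul_eq_zero {z u w : S K (n + 2) lam} {M : ℕ}
    (hM : ∀ j, M ≤ j → u * C1 ^ j * w = 0) {v : Rep K} {b : ℕ → Vertex × ℕ}
    (hb : Function.Injective b) {q : Vertex × ℕ} {t : K} (hq : q ≠ b 0)
    (h0 : act w (act (C1 ^ 0) (act u (act z v))) = .single (b 0) 1 + .single q t)
    (hv : ∀ j, 0 < j → j < M → act w (act (C1 ^ j) (act u (act z v))) = .single (b j) 1)
    {p : Polynomial K} (h : z * (u * Polynomial.aeval C1 p * w) = 0) :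
    u * Polynomial.aeval C1 p * w = 0 := by
  let f : Polynomial K →ₗ[K] S K (n + 2) lam :=
    LinearMap.mulRight K w ∘ₗ LinearMap.mulLeft K u ∘ₗ (Polynomial.aeval C1).toLinearMap
  let ev : S K (n + 2) lam →ₗ[K] Rep K :=
    LinearMap.applyₗ v ∘ₗ (MulOpposite.opLinearEquiv K).symm.toLinearMap ∘ₗ
      (repHom K n lam).toLinearMap
  have hev (x) : ev x = act x v := rfl
  have hf (p) : f p = u * Polynomial.aeval C1 p * w := rfl
  have hfX (j) : f (Polynomial.X ^ j) = u * C1 ^ j * w := by simp [hf]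
  have hfM (j) (hj : M ≤ j) : f (Polynomial.X ^ j) = 0 := by rw [hfX, hM j hj]
  have h1 := apply_eq_sum_range (ev ∘ₗ LinearMap.mulLeft K z ∘ₗ f) (M := M)
    (fun j hj => by simp only [LinearMap.comp_apply, hfM j hj, map_zero]) p
  have h2 (p) : (ev ∘ₗ LinearMap.mulLeft K z ∘ₗ f) p =
      act (z * (u * Polynomial.aeval C1 p * w)) v := rfl
  rw [h2, h, ← hev, map_zero] at h1
  rw [← hf, apply_eq_sum_range f hfM p]
  refine Finset.sum_eq_zero fun j hj => ?_
  rw [coeff_eq_zero_of_sum_eq_zero hb hq (t := t) ?_ ?_ h1.symm j (Finset.mem_range.1 hj),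
    zero_smul]
  · rw [h2, ← h0]
    simp only [act_mul, map_pow, Polynomial.aeval_X]
  · intro j hj hjM
    rw [h2, ← hv j hj hjM]
    simp only [act_mul, map_pow, Polynomial.aeval_X]

lemma mul_cyc_pow_mul_eq_zero {u w : S K (n + 2) lam} {M : ℕ} (h : u * C1 ^ M * w = 0)
    (h' : u * C1 ^ (M + 1) = 0) (j : ℕ) (hj : M ≤ j) : u * C1 ^ j * w = 0 := by
  rcases hj.eq_or_lt with rfl | hj
  · exact h
  · obtain ⟨k, rfl⟩ := Nat.exists_eq_add_of_le (Nat.succ_le_of_lt hj)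
    rw [pow_add, ← mul_assoc, Nat.succ_eq_add_one, h', zero_mul, zero_mul]

lemma mk_injective (i : Vertex) (s : ℕ) : Function.Injective fun j : ℕ => (i, j + s) :=
  fun j k h => by simpa using h

/-- Left multiplication by `γ` is injective on `e₄Seᵢ` for `i ≠ 4, 5`. -/
theorem eq_zero_of_gamma_mul (hlam : lam ≠ 0) {i : Vertex} (h4 : i ≠ .v4) (h5 : i ≠ .v5)
    {x : S K (n + 2) lam} (hx : e K (n + 2) lam .v4 * x = x)
    (hx' : x * e K (n + 2) lam i = x) (h : arrow K (n + 2) lam .γ * x = 0) : x = 0 := by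
  have hm : 2 ≤ n + 2 := by omega
  obtain ⟨y, hy⟩ := exists_e4_mul_e h4 x
  rw [hx, hx'] at hy
  have hs (w) := mul_cyc_pow_mul_eq_zero (n := n) (lam := lam) (w := w) (M := n + 2)
    (by rw [sigma_mul_cyc_pow hm hlam, zero_mul])
    (by rw [pow_succ, ← mul_assoc, sigma_mul_cyc_pow hm hlam, zero_mul])
  -- The test vector is (3, 0). Since γσ sends it to the single basis vector (1, 0), no correction
  -- term arises, and `q` below is a dummy with coefficient `t = 0`.
  have ha : act (arrow K (n + 2) lam .σ) (act (arrow K (n + 2) lam .γ) (.single (.v3, 0) 1)) =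
      .single (.v1, 0) 1 := by
    simp (disch := omega) only [act_arrow, gamma_of_lt, sigma_of_lt]
  cases i with
  | v1 =>
    obtain ⟨p, hp⟩ := exists_e1_mul_e1 hm y
    rw [hp, ← mul_assoc] at hy
    rw [hy] at h ⊢
    have hj (j) (hj : j < n + 2) : act (e K (n + 2) lam .v1) (act (C1 ^ j) (act
        (arrow K (n + 2) lam .σ) (act (arrow K (n + 2) lam .γ) (.single (.v3, 0) 1)))) =
        .single (.v1, j + 0) 1 := by
      rw [ha]
      simp (disch := omega) only [act_cyc_pow, act_e, opVertex_single, if_true, add_zero]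
    exact mul_aeval_mul_eq_zero (hs _) (mk_injective .v1 0) (q := (.v2, 0)) (t := 0) (by simp)
      (by simpa using hj 0 (by omega)) (fun j _ h => hj j h) h
  | v2 =>
    obtain ⟨p, hp⟩ := exists_e1_mul_e2 hm y
    rw [hp, ← mul_assoc] at hy
    rw [hy] at h ⊢
    have hj (j) (hj : j < n + 2) : act (arrow K (n + 2) lam .α) (act (C1 ^ j) (act
        (arrow K (n + 2) lam .σ) (act (arrow K (n + 2) lam .γ) (.single (.v3, 0) 1)))) =
        .single (.v2, j + 0) 1 := by
      rw [ha]
      simp (disch := omega) only [act_cyc_pow, act_arrow, alpha_of_lt, add_zero]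
    exact mul_aeval_mul_eq_zero (hs _) (mk_injective .v2 0) (q := (.v1, 0)) (t := 0) (by simp)
      (by simpa using hj 0 (by omega)) (fun j _ h => hj j h) h
  | v3 =>
    obtain ⟨p, hp⟩ := exists_sigma_mul_e3 hm y
    rw [hp] at hy
    rw [hy] at h ⊢
    have hj (j) (hj : j < n + 2) : act (arrow K (n + 2) lam .α * arrow K (n + 2) lam .β)
        (act (C1 ^ j) (act (arrow K (n + 2) lam .σ) (act (arrow K (n + 2) lam .γ)
          (.single (.v3, 0) 1)))) = .single (.v3, j + 1) 1 := by
      rw [ha]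
      simp (disch := omega) only [act_cyc_pow, act_arrow, alpha_of_lt, beta_of_lt, act_mul]
    exact mul_aeval_mul_eq_zero (hs _) (mk_injective .v3 1) (q := (.v1, 0)) (t := 0) (by simp)
      (by simpa using hj 0 (by omega)) (fun j _ h => hj j h) h
  | v6 =>
    obtain ⟨p, hp⟩ := exists_e1_mul_e6 hm y
    rw [hp, ← mul_assoc] at hy
    rw [hy] at h ⊢
    have hj (j) (hj : j < n + 2) : act (arrow K (n + 2) lam .ρ) (act (C1 ^ j) (act
        (arrow K (n + 2) lam .σ) (act (arrow K (n + 2) lam .γ) (.single (.v3, 0) 1)))) =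
        .single (.v6, j + 0) 1 := by
      rw [ha]
      simp (disch := omega) only [act_cyc_pow, act_arrow, rho_of_lt, add_zero]
    exact mul_aeval_mul_eq_zero (hs _) (mk_injective .v6 0) (q := (.v1, 0)) (t := 0) (by simp)
      (by simpa using hj 0 (by omega)) (fun j _ h => hj j h) h
  | v4 => exact (h4 rfl).elim
  | v5 => exact (h5 rfl).elim

set_option linter.unusedSimpArgs false in
/-- Left multiplication by `ν` is injective on `e₅Seᵢ` for `i ≠ 5`. -/
theorem eq_zero_of_nu_mul (hlam : lam ≠ 0) {i : Vertex} (h5 : i ≠ .v5)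
    {x : S K (n + 2) lam} (hx : e K (n + 2) lam .v5 * x = x)
    (hx' : x * e K (n + 2) lam i = x) (h : arrow K (n + 2) lam .ν * x = 0) : x = 0 := by
  have hm : 2 ≤ n + 2 := by omega
  obtain ⟨y, hy⟩ := exists_e5_mul_e h5 x
  rw [hx, hx'] at hy
  have hs (w) := mul_cyc_pow_mul_eq_zero (n := n) (lam := lam) (w := w) (M := n + 2)
    (by rw [delta_mul_cyc_pow hm hlam, zero_mul])
    (by rw [pow_succ, ← mul_assoc, delta_mul_cyc_pow hm hlam, zero_mul])
  -- For paths ending at 4 the truncation is at m - 1 instead of m, as δCᵐ⁻¹αβγ is already zero.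
  have hs' := mul_cyc_pow_mul_eq_zero (n := n) (lam := lam) (M := n + 1)
    (delta_mul_cyc_pow_pred hlam) (delta_mul_cyc_pow hm hlam)
  -- Unlike γσ, the path νδ sends (3, 0) to (1, 0) + (1, m). As C kills (1, m), only the vector for
  -- j = 0 can carry a correction term: the image of (1, m) under the short path.
  have h0 : act (C1 ^ 0) (act (arrow K (n + 2) lam .δ) (act (arrow K (n + 2) lam .ν)
      (.single (.v3, 0) 1))) = .single (.v1, 0) 1 + .single (.v1, n + 2) 1 := by
    simp (disch := omega) only [act_arrow, nu_of_lt, delta_of_eq]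
    simp [act]
  have ha (j) (hj0 : 0 < j) (hj : j < n + 2) : act (C1 ^ j) (act (arrow K (n + 2) lam .δ)
      (act (arrow K (n + 2) lam .ν) (.single (.v3, 0) 1))) = .single (.v1, j) 1 := by
    simp (disch := omega) only [act_arrow, nu_of_lt, delta_of_eq, map_add, act_cyc_pow,
      act_cyc_pow_top, add_zero]
  cases i with
  | v1 =>
    obtain ⟨p, hp⟩ := exists_e1_mul_e1 hm y
    rw [hp, ← mul_assoc] at hy
    rw [hy] at h ⊢
    refine mul_aeval_mul_eq_zero (v := .single (.v3, 0) 1) (hs _)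
      (mk_injective .v1 0) (q := (.v1, n + 2)) (t := 1)
      (by simp) ?_ (fun j h0 hj => ?_) h
    · rw [h0]
      simp (disch := omega) only [map_add, act_e, opVertex_single, if_true, zero_add, add_zero, one_mul,
        Finsupp.single_zero]
    · rw [ha j h0 (by omega)]
      simp (disch := omega) only [act_e, opVertex_single, if_true, add_zero]
  | v2 =>
    obtain ⟨p, hp⟩ := exists_e1_mul_e2 hm y
    rw [hp, ← mul_assoc] at hy
    rw [hy] at h ⊢
    refine mul_aeval_mul_eq_zero (v := .single (.v3, 0) 1) (hs _)
      (mk_injective .v2 0) (q := (.v2, n + 1)) (t := lam)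
      (by simp) ?_ (fun j h0 hj => ?_) h
    · rw [h0]
      simp (disch := omega) only [map_add, act_arrow, alpha_of_lt, alpha_of_eq, zero_add, add_zero, one_mul,
        Finsupp.single_zero]
    · rw [ha j h0 (by omega)]
      simp (disch := omega) only [act_arrow, alpha_of_lt, alpha_of_eq, add_zero]
  | v3 =>
    obtain ⟨p, hp⟩ := exists_delta_mul_e3 hm y
    rw [hp] at hy
    rw [hy] at h ⊢
    refine mul_aeval_mul_eq_zero (v := .single (.v3, 0) 1) (hs _)
      (mk_injective .v3 1) (q := (.v3, n + 2)) (t := lam)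
      (by simp) ?_ (fun j h0 hj => ?_) h
    · rw [h0]
      simp (disch := omega) only [map_add, act_mul, act_arrow, alpha_of_lt, alpha_of_eq, beta_of_lt, zero_add, add_zero, one_mul,
        Finsupp.single_zero]
    · rw [ha j h0 (by omega)]
      simp (disch := omega) only [act_mul, act_arrow, alpha_of_lt, alpha_of_eq, beta_of_lt, add_zero]
  | v4 =>
    obtain ⟨p, hp⟩ := exists_e1_mul_e4 hm y
    rw [hp, ← mul_assoc] at hy
    rw [hy] at h ⊢
    refine mul_aeval_mul_eq_zero (v := .single (.v3, 0) 1) hs' (mk_injective .v4 1) (q := (.v1, 0)) (t := 0)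
      (by simp) ?_ (fun j h0 hj => ?_) h
    · rw [h0]
      simp (disch := omega) only [map_add, act_mul, act_arrow, alpha_of_lt, alpha_of_eq, beta_of_lt,
        gamma_of_lt, gamma_of_ge, zero_add, add_zero, one_mul,
        Finsupp.single_zero]
    · rw [ha j h0 (by omega)]
      simp (disch := omega) only [act_mul, act_arrow, alpha_of_lt, alpha_of_eq, beta_of_lt,
        gamma_of_lt, gamma_of_ge, add_zero]
  | v6 =>
    obtain ⟨p, hp⟩ := exists_e1_mul_e6 hm y
    rw [hp, ← mul_assoc] at hy
    rw [hy] at h ⊢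
    refine mul_aeval_mul_eq_zero (v := .single (.v3, 0) 1) (hs _)
      (mk_injective .v6 0) (q := (.v1, 0)) (t := 0)
      (by simp) ?_ (fun j h0 hj => ?_) h
    · rw [h0]
      simp (disch := omega) only [map_add, act_arrow, rho_of_lt, rho_of_ge, zero_add, add_zero, one_mul,
        Finsupp.single_zero]
    · rw [ha j h0 (by omega)]
      simp (disch := omega) only [act_arrow, rho_of_lt, rho_of_ge, add_zero]
  | v5 => exact (h5 rfl).elim

end Injectivity

end HigherSpherical

namespace HigherSpherical

/-! ### Finitely generated projective modules are sums of the modules P_i -/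

section Projectives

open MulOpposite

variable {K : Type u} [Field K] {m : ℕ} {lam : K}

lemma mem_idealP {i : Vertex} {x : S K m lam} :
    x ∈ idealP K m lam i ↔ e K m lam i * x = x := by
  constructor
  · rintro ⟨y, rfl⟩
    change e K m lam i * (e K m lam i * y) = e K m lam i * y
    rw [← mul_assoc, e_mul_e, if_pos rfl]
  · exact fun h => ⟨x, h⟩

variable (K m lam) in
/-- The inclusion of `Pᵢ = eᵢS` into `S`. -/
noncomputable def incl (i : Vertex) : P K m lam i →ₗ[(S K m lam)ᵐᵒᵖ] S K m lam :=
  (idealP K m lam i).subtype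

lemma incl_injective (i : Vertex) : Function.Injective (incl K m lam i) :=
  Subtype.val_injective

lemma e_mul_incl {i : Vertex} (x : P K m lam i) :
    e K m lam i * incl K m lam i x = incl K m lam i x :=
  mem_idealP.1 (Subtype.property (p := (· ∈ idealP K m lam i)) x)

variable (K m lam) in
/-- The element of `Pᵢ` given by an element of `eᵢS`. -/
noncomputable def toP (i : Vertex) (x : S K m lam) (hx : e K m lam i * x = x) : P K m lam i :=
  (⟨x, mem_idealP.2 hx⟩ : idealP K m lam i)

lemma incl_smul {i : Vertex} (x : P K m lam i) (r : (S K m lam)ᵐᵒᵖ) :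
    incl K m lam i (r • x) = incl K m lam i x * r.unop := rfl

variable (K m lam) in
/-- The trivial path at `i` as an element of `Pᵢ`. -/
noncomputable def eP (i : Vertex) : P K m lam i :=
  toP K m lam i (e K m lam i) (by rw [e_mul_e, if_pos rfl])

lemma op_smul_eP {i : Vertex} (x : P K m lam i) :
    op (incl K m lam i x) • eP K m lam i = x :=
  incl_injective i (e_mul_incl x)

/-- The right module `Pᵢ` is a direct summand of `S`. -/
noncomputable def projP (i : Vertex) : S K m lam →ₗ[(S K m lam)ᵐᵒᵖ] P K m lam i :=
  (leftMul K m lam (e K m lam i)).rangeRestrict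

instance (i : Vertex) : Module.Projective (S K m lam)ᵐᵒᵖ (P K m lam i) := by
  have : Module.Projective (S K m lam)ᵐᵒᵖ (S K m lam) :=
    Module.Projective.of_equiv (MulOpposite.opLinearEquiv (S K m lam)ᵐᵒᵖ :
      S K m lam ≃ₗ[(S K m lam)ᵐᵒᵖ] (S K m lam)ᵐᵒᵖ).symm
  exact Module.Projective.of_split (incl K m lam i) (projP i)
    (LinearMap.ext fun x => incl_injective i (e_mul_incl x))

instance (i : Vertex) : Module.Finite (S K m lam)ᵐᵒᵖ (P K m lam i) := by
  refine ⟨{eP K m lam i}, ?_⟩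
  rw [eq_top_iff]
  intro x _
  rw [← op_smul_eP x, Finset.coe_singleton]
  exact Submodule.smul_mem _ _ (Submodule.subset_span rfl)

variable {X : Type u} [AddCommGroup X] [Module (S K m lam)ᵐᵒᵖ X]

/-- The homomorphism `S → X` of right modules which maps `1` to `p`. -/
def ofElement (p : X) : S K m lam →ₗ[(S K m lam)ᵐᵒᵖ] X where
  toFun x := op x • p
  map_add' x y := by rw [MulOpposite.op_add, add_smul]
  map_smul' r x := by
    change op (x * r.unop) • p = r • op x • p
    rw [op_mul, op_unop, mul_smul]

variable (K m lam) in
/-- A family of generators, each of which is supported at a vertex. -/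
structure IsVertexGenerating {n : ℕ} (i : Fin n → Vertex) (p : Fin n → X) : Prop where
  op_e_smul : ∀ k, op (e K m lam (i k)) • p k = p k
  span_eq_top : Submodule.span (S K m lam)ᵐᵒᵖ (Set.range p) = ⊤

lemma exists_isVertexGenerating [Module.Finite (S K m lam)ᵐᵒᵖ X] :
    ∃ (n : ℕ) (i : Fin n → Vertex) (p : Fin n → X),
      IsVertexGenerating K m lam i p := by
  obtain ⟨n, s, hs⟩ := Module.Finite.exists_fin (R := (S K m lam)ᵐᵒᵖ) (M := X)
  let φ := (Fintype.equivFin (Fin n × Vertex)).symm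
  refine ⟨_, fun k => (φ k).2, fun k => op (e K m lam (φ k).2) • s (φ k).1, fun k => ?_, ?_⟩
  · rw [← mul_smul, ← op_mul, e_mul_e, if_pos rfl]
  · rw [eq_top_iff, ← hs, Submodule.span_le]
    rintro _ ⟨k, rfl⟩
    have h : s k = ∑ j, op (e K m lam j) • s k := by
      rw [← Finset.sum_smul, ← Finset.op_sum, sum_e, op_one, one_smul]
    rw [h]
    refine Submodule.sum_mem _ fun j _ => Submodule.subset_span ⟨φ.symm (k, j), ?_⟩
    simp

variable (K m lam) in
/-- The homomorphism from a direct sum of modules `Pᵢ` given by a family of elements. -/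
noncomputable def ofFamily {n : ℕ} (i : Fin n → Vertex) (p : Fin n → X) :
    ((k : Fin n) → P K m lam (i k)) →ₗ[(S K m lam)ᵐᵒᵖ] X :=
  ∑ k, ofElement (p k) ∘ₗ incl K m lam (i k) ∘ₗ LinearMap.proj k

lemma ofFamily_apply {n : ℕ} (i : Fin n → Vertex) (p : Fin n → X)
    (q : (k : Fin n) → P K m lam (i k)) :
    ofFamily K m lam i p q = ∑ k, op (incl K m lam (i k) (q k)) • p k := by
  simp [ofFamily, ofElement]

lemma IsVertexGenerating.ofFamily_surjective {n : ℕ} {i : Fin n → Vertex} {p : Fin n → X}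
    (h : IsVertexGenerating K m lam i p) :
    Function.Surjective (ofFamily K m lam i p) := by
  rw [← LinearMap.range_eq_top, eq_top_iff, ← h.span_eq_top, Submodule.span_le]
  rintro _ ⟨k, rfl⟩
  refine ⟨Pi.single k (eP K m lam (i k)), ?_⟩
  rw [ofFamily_apply, Finset.sum_eq_single k]
  · rw [Pi.single_eq_same]
    exact h.op_e_smul k
  · intro l _ hl
    rw [Pi.single_eq_of_ne hl]
    simp
  · simp

lemma augmentation_eq_zero_of_mem {i : Vertex} {x : S K m lam} (hx : e K m lam i * x = x)
    (h : augmentation K m lam x i = 0) : x ∈ radical K m lam := by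
  rw [mem_radical, ← hx, map_mul, augmentation_e]
  ext j
  by_cases hj : j = i
  · subst hj; simp [h]
  · simp [hj]

/-- In a generating family without redundant members the relations have their coefficients in the
radical. -/
lemma IsVertexGenerating.mem_radical_of_ofFamily_eq_zero (hm : 2 ≤ m) {n : ℕ}
    {i : Fin (n + 1) → Vertex} {p : Fin (n + 1) → X}
    (h : IsVertexGenerating K m lam i p)
    (hmin : ¬ ∃ (i' : Fin n → Vertex) (p' : Fin n → X),
      IsVertexGenerating K m lam i' p')
    {q : (k : Fin (n + 1)) → P K m lam (i k)} (hq : ofFamily K m lam i p q = 0)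
    (k : Fin (n + 1)) : incl K m lam (i k) (q k) ∈ radical K m lam := by
  by_contra hk
  have hx := e_mul_incl (q k)
  set x : S K m lam := incl K m lam (i k) (q k) with hxdef
  set c := augmentation K m lam x (i k) with hcdef
  have hc : c ≠ 0 := fun h0 => hk (augmentation_eq_zero_of_mem hx h0)
  refine hmin ⟨i ∘ k.succAbove, p ∘ k.succAbove, fun l => h.op_e_smul _, ?_⟩
  set N := Submodule.span (S K m lam)ᵐᵒᵖ (Set.range (p ∘ k.succAbove)) with hN
  -- A coefficient x outside the radical satisfies xeᵢ = ceᵢ + j with c ≠ 0 and j in the radical.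
  -- Because pₖeᵢ = pₖ, the element xeᵢ acts on pₖ like the unit c + j = cu, so pₖ lies in the span
  -- of the other generators, contrary to minimality.
  have hj : x * e K m lam (i k) - c • e K m lam (i k) ∈ radical K m lam := by
    rw [mem_radical, map_sub, map_mul, map_smul, augmentation_e]
    ext l
    by_cases hl : l = i k
    · subst hl; simp [hcdef]
    · simp [hl]
  set j := x * e K m lam (i k) - c • e K m lam (i k) with hjdef
  have hu : IsUnit (1 + c⁻¹ • j) :=
    (isNilpotent_of_mem_radical hm (Submodule.smul_mem _ _ hj)).isUnit_one_add
  obtain ⟨u, hu⟩ := hu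
  have hxN : op x • p k ∈ N := by
    rw [ofFamily_apply, Fin.sum_univ_succAbove _ k, add_eq_zero_iff_eq_neg] at hq
    rw [hxdef, hq]
    refine N.neg_mem (N.sum_mem fun l _ => N.smul_mem _ (Submodule.subset_span ⟨l, rfl⟩))
  have hcu : op (c • (u : S K m lam)) • p k ∈ N := by
    have h1 : op (c • (u : S K m lam)) • p k = op (e K m lam (i k)) • op x • p k := by
      rw [← mul_smul, ← op_mul, show x * e K m lam (i k) = j + c • e K m lam (i k) by
        rw [hjdef, sub_add_cancel], hu, smul_add, smul_smul, mul_inv_cancel₀ hc, one_smul,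
        add_comm j, MulOpposite.op_add, MulOpposite.op_add,
        add_smul, add_smul]
      congr 1
      conv_lhs => rw [← h.op_e_smul k, ← mul_smul, ← op_mul, mul_smul_comm, mul_one]
    rw [h1]
    exact N.smul_mem _ hxN
  have hpk : p k ∈ N := by
    have h2 : p k = op (c⁻¹ • (↑u⁻¹ : S K m lam)) • op (c • (u : S K m lam)) • p k := by
      rw [← mul_smul, ← op_mul, smul_mul_smul_comm, mul_inv_cancel₀ hc, Units.mul_inv, one_smul,
        op_one, one_smul]
    rw [h2]
    exact N.smul_mem _ hcu
  rw [eq_top_iff, ← h.span_eq_top, Submodule.span_le]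
  rintro _ ⟨l, rfl⟩
  by_cases hl : l = k
  · rw [hl]; exact hpk
  · obtain ⟨l', rfl⟩ := Fin.exists_succAbove_eq hl
    exact Submodule.subset_span ⟨l', rfl⟩

/-- Every finitely generated projective right module is a finite direct sum of modules `Pᵢ`. -/
theorem exists_equiv_pi_P (hm : 2 ≤ m) [Module.Finite (S K m lam)ᵐᵒᵖ X]
    [Module.Projective (S K m lam)ᵐᵒᵖ X] :
    ∃ (n : ℕ) (i : Fin n → Vertex),
      Nonempty (X ≃ₗ[(S K m lam)ᵐᵒᵖ] ((k : Fin n) → P K m lam (i k))) := by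
  classical
  have hex := exists_isVertexGenerating (K := K) (m := m) (lam := lam) (X := X)
  obtain ⟨n, ⟨i, p, h⟩, hmin⟩ : ∃ n, (∃ (i : Fin n → Vertex) (p : Fin n → X),
      IsVertexGenerating K m lam i p) ∧ ∀ l < n, ¬ ∃ (i : Fin l → Vertex) (p : Fin l → X),
      IsVertexGenerating K m lam i p :=
    ⟨_, Nat.find_spec hex, fun l hl => Nat.find_min hex hl⟩
  refine ⟨n, i, ⟨(LinearEquiv.ofBijective (ofFamily K m lam i p) ⟨?_, h.ofFamily_surjective⟩).symm⟩⟩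
  have hrad {q} (hq : ofFamily K m lam i p q = 0) (k : Fin n) : incl K m lam (i k) (q k) ∈ radical K m lam := by
    have hn : n ≠ 0 := fun h0 => (Fin.cast h0 k).elim0
    obtain ⟨l, rfl⟩ := Nat.exists_eq_succ_of_ne_zero hn
    exact h.mem_radical_of_ofFamily_eq_zero hm (hmin l (Nat.lt_succ_self l)) hq k
  obtain ⟨s, hs⟩ := Module.projective_lifting_property (ofFamily K m lam i p)
    LinearMap.id h.ofFamily_surjective
  have hs' (x) : ofFamily K m lam i p (s x) = x := LinearMap.congr_fun hs x
  let ε (k : Fin n) : (k : Fin n) → P K m lam (i k) := Pi.single k (eP K m lam (i k))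
  -- Projection onto the kernel of the cover. For q in the kernel, q = π(q) = ∑ π(εᵣ)qᵣ, where both
  -- π(εᵣ) and q are relations. If the coefficients of relations lie in a power of the radical, this
  -- formula puts them in the next power, and nilpotency makes the kernel zero.
  let π := LinearMap.id (R := (S K m lam)ᵐᵒᵖ) (M := (k : Fin n) → P K m lam (i k)) -
    s.comp (ofFamily K m lam i p)
  have hπ' (q : (k : Fin n) → P K m lam (i k)) (hq : ofFamily K m lam i p q = 0) : π q = q := by
    rw [LinearMap.sub_apply, LinearMap.comp_apply, hq, map_zero]
    exact sub_zero q
  have hπ (q : (k : Fin n) → P K m lam (i k)) : ofFamily K m lam i p (π q) = 0 := by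
    rw [LinearMap.sub_apply, LinearMap.comp_apply, map_sub, hs']
    exact sub_self _
  have hpow (l : ℕ) : ∀ q, ofFamily K m lam i p q = 0 → ∀ k, incl K m lam (i k) (q k) ∈
      radical K m lam ^ (l + 1) := by
    induction l with
    | zero => simpa using fun q hq k => hrad hq k
    | succ l ih =>
      intro q hq k
      have hq1 : q = ∑ r, op (incl K m lam (i r) (q r)) • ε r := by
        ext1 t
        rw [Finset.sum_apply, Finset.sum_eq_single t]
        · simp only [ε, Pi.smul_apply, Pi.single_eq_same, op_smul_eP]
        · intro r _ hr
          simp only [ε, Pi.smul_apply, Pi.single_eq_of_ne hr.symm, smul_zero]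
        · simp
      have hq2 : q = ∑ r, op (incl K m lam (i r) (q r)) • π (ε r) := by
        conv_lhs => rw [← hπ' q hq, hq1]
        simp only [map_sum, map_smul]
      have hk : incl K m lam (i k) (q k) = ∑ r, incl K m lam (i k) (π (ε r) k) * incl K m lam (i r) (q r) := by
        conv_lhs => rw [hq2]
        rw [Finset.sum_apply, map_sum]
        rfl
      rw [hk, pow_succ]
      exact sum_mem fun r _ => Submodule.mul_mem_mul (ih _ (hπ _) k) (hrad hq r)
  rw [← LinearMap.ker_eq_bot, eq_bot_iff]
  intro q hq
  rw [Submodule.mem_bot]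
  refine funext fun k => incl_injective _ ?_
  have := hpow (4 * (m + 1) + 2) q hq k
  rw [radical_pow_eq_bot hm, Submodule.mem_bot] at this
  exact this

end Projectives

end HigherSpherical

namespace Tilting

open Pretriangulated

/-! ### Triangles and vanishing of morphisms for two-term complexes -/

section Homotopy

variable {C : Type*} [Category C] [Abelian C]

section Triangles

variable (Q : ObjectProperty (HomotopyCategory C (ComplexShape.up ℤ))) [Q.IsTriangulated]
  [Q.IsClosedUnderIsomorphisms]

lemma trianglehOfDegreewiseSplit_mem (S : ShortComplex (CochainComplex C ℤ))
    (σ : ∀ n, (S.map (HomologicalComplex.eval C _ n)).Splitting) :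
    CochainComplex.trianglehOfDegreewiseSplit S σ ∈ distTriang _ :=
  (HomotopyCategory.distinguished_iff_iso_trianglehOfDegreewiseSplit _).2 ⟨S, σ, ⟨Iso.refl _⟩⟩

lemma quotient_mem₂_of_degreewiseSplit (S : ShortComplex (CochainComplex C ℤ))
    (σ : ∀ n, (S.map (HomologicalComplex.eval C _ n)).Splitting)
    (h₁ : Q ((HomotopyCategory.quotient C _).obj S.X₁)) (h₃ : Q ((HomotopyCategory.quotient C _).obj S.X₃)) : Q ((HomotopyCategory.quotient C _).obj S.X₂) :=
  Q.ext_of_isTriangulatedClosed₂ _ (trianglehOfDegreewiseSplit_mem S σ) h₁ h₃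

lemma quotient_mem₃_of_degreewiseSplit (S : ShortComplex (CochainComplex C ℤ))
    (σ : ∀ n, (S.map (HomologicalComplex.eval C _ n)).Splitting)
    (h₁ : Q ((HomotopyCategory.quotient C _).obj S.X₁)) (h₂ : Q ((HomotopyCategory.quotient C _).obj S.X₂)) : Q ((HomotopyCategory.quotient C _).obj S.X₃) :=
  Q.ext_of_isTriangulatedClosed₃ _ (trianglehOfDegreewiseSplit_mem S σ) h₁ h₂

lemma single_mem_of_single_mem (M : C) (a b : ℤ)
    (h : Q ((HomotopyCategory.singleFunctor C a).obj M)) :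
    Q ((HomotopyCategory.singleFunctor C b).obj M) :=
  Q.prop_of_iso (((HomotopyCategory.singleFunctors C).shiftIso (a - b) b a (by ring)).app M)
    (Q.le_shift (a - b) _ h)

/-- The degreewise split short exact sequence which relates a two-term complex to its terms. -/
noncomputable def doubleShortComplex {A B : C} (f : A ⟶ B)
    (h : (ComplexShape.up ℤ).Rel (-1) 0) : ShortComplex (CochainComplex C ℤ) where
  X₁ := (CochainComplex.singleFunctor C 0).obj B
  X₂ := HomologicalComplex.double f h
  X₃ := (CochainComplex.singleFunctor C (-1)).obj A
  f := HomologicalComplex.mkHomFromSingle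
    (HomologicalComplex.doubleXIso₁ f h (by decide)).inv
    (fun k _ => by
      rw [HomologicalComplex.double_d_eq_zero₀ _ _ _ _ (by decide), comp_zero])
  g := HomologicalComplex.mkHomToSingle (HomologicalComplex.doubleXIso₀ f h).hom
    (fun k _ => by
      rw [HomologicalComplex.double_d_eq_zero₁ _ _ _ _ (by decide), zero_comp])
  zero := by
    ext k
    by_cases hk : k = 0
    · subst hk
      exact (HomologicalComplex.isZero_single_obj_X _ _ _ _ (by decide)).eq_of_tgt _ _
    · exact (HomologicalComplex.isZero_single_obj_X _ _ _ _ hk).eq_of_src _ _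

/-- The splittings of `doubleShortComplex`. -/
noncomputable def doubleShortComplexSplitting {A B : C} (f : A ⟶ B)
    (h : (ComplexShape.up ℤ).Rel (-1) 0) (k : ℤ) :
    ((doubleShortComplex f h).map (HomologicalComplex.eval C _ k)).Splitting := by
  by_cases h0 : k = 0
  · subst h0
    have hz : IsZero (((CochainComplex.singleFunctor C (-1)).obj A).X 0) :=
      HomologicalComplex.isZero_single_obj_X (ComplexShape.up ℤ) (-1) A 0 (by decide)
    have hf : (doubleShortComplex f h).f.f 0 =
        (HomologicalComplex.singleObjXSelf (ComplexShape.up ℤ) 0 B ≪≫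
          (HomologicalComplex.doubleXIso₁ f h (by decide)).symm).hom :=
      HomologicalComplex.mkHomFromSingle_f (K := HomologicalComplex.double f h) _ fun k _ => by
        rw [HomologicalComplex.double_d_eq_zero₀ _ _ _ _ (by decide), comp_zero]
    have hi : IsIso ((doubleShortComplex f h).f.f 0) := by
      rw [hf]
      exact Iso.isIso_hom _
    exact ShortComplex.Splitting.ofIsIsoOfIsZero _ hi hz
  · by_cases h1 : k = -1
    · subst h1
      have hz : IsZero (((CochainComplex.singleFunctor C 0).obj B).X (-1)) :=
        HomologicalComplex.isZero_single_obj_X (ComplexShape.up ℤ) 0 B (-1) (by decide)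
      have hg : (doubleShortComplex f h).g.f (-1) =
          (HomologicalComplex.doubleXIso₀ f h ≪≫
            (HomologicalComplex.singleObjXSelf (ComplexShape.up ℤ) (-1) A).symm).hom :=
        HomologicalComplex.mkHomToSingle_f (K := HomologicalComplex.double f h) _ fun k _ => by
          rw [HomologicalComplex.double_d_eq_zero₁ _ _ _ _ (by decide), zero_comp]
      have hi : IsIso ((doubleShortComplex f h).g.f (-1)) := by
        rw [hg]
        exact Iso.isIso_hom _
      exact ShortComplex.Splitting.ofIsZeroOfIsIso _ hz hi
    · exact
        { r := 0
          s := 0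
          f_r := (HomologicalComplex.isZero_single_obj_X (ComplexShape.up ℤ) _ _ _ h0).eq_of_src _ _
          s_g := (HomologicalComplex.isZero_single_obj_X (ComplexShape.up ℤ) _ _ _ h1).eq_of_src _ _
          id := (HomologicalComplex.isZero_double_X f h k h1 h0).eq_of_src _ _ }

/-- The degreewise split sequence from B in degree 0 through the two-term complex to A in degree -1
gives a triangle with two vertices in Q; a shift brings A to degree 0. -/
lemma single_mem_of_double_mem {A B : C} (f : A ⟶ B) (h : (ComplexShape.up ℤ).Rel (-1) 0)
    (hB : Q ((HomotopyCategory.quotient C _).obj ((CochainComplex.singleFunctor C 0).obj B)))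
    (hf : Q ((HomotopyCategory.quotient C _).obj (HomologicalComplex.double f h))) :
    Q ((HomotopyCategory.quotient C _).obj ((CochainComplex.singleFunctor C 0).obj A)) :=
  single_mem_of_single_mem Q A (-1) 0
    (quotient_mem₃_of_degreewiseSplit Q _ (doubleShortComplexSplitting f h) hB hf)

end Triangles

section HomVanishing

/-- A criterion for a morphism between shifted two-term complexes to be zero. -/
theorem hom_shift_eq_zero_of_twoTerm {X Y : CochainComplex C ℤ}
    (hX : ∀ k, k ≠ -1 → k ≠ 0 → IsZero (X.X k)) (hY : ∀ k, k ≠ -1 → k ≠ 0 → IsZero (Y.X k))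
    (hinj : ∀ g : X.X 0 ⟶ Y.X (-1), g ≫ Y.d (-1) 0 = 0 → g = 0)
    (hfac : ∀ g : X.X (-1) ⟶ Y.X 0, ∃ h : X.X 0 ⟶ Y.X 0, g = X.d (-1) 0 ≫ h)
    (i : ℤ) (hi : i ≠ 0) (f : (HomotopyCategory.quotient C _).obj X ⟶ ((HomotopyCategory.quotient C _).obj Y)⟦i⟧) : f = 0 := by
  -- The shift is moved inside the quotient functor, so that g is an honest chain map from X to the
  -- shifted complex.
  obtain ⟨g, hg⟩ := (HomotopyCategory.quotient C _).map_surjective (f ≫ (((HomotopyCategory.quotient C _).commShiftIso i).inv.app Y))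
  suffices h : (HomotopyCategory.quotient C _).map g = 0 by
    rw [h] at hg
    rw [← cancel_mono (((HomotopyCategory.quotient C _).commShiftIso i).inv.app Y), ← hg, zero_comp]
  have hZ (k : ℤ) (h1 : k + i ≠ -1) (h0 : k + i ≠ 0) :
      IsZero (((shiftFunctor (CochainComplex C ℤ) i).obj Y).X k) := hY _ h1 h0
  by_cases h1 : i = 1
  · subst h1
    obtain ⟨h, hh⟩ := hfac (g.f (-1))
    rw [HomotopyCategory.quotient_map_eq_zero_iff]
    -- The homotopy has one nonzero component, h from X⁰ to Y⁰, which is the term of Y[1] of degree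
    -- -1. Its equation is the given factorization in degree -1; in all other degrees source or
    -- target is zero.
    refine ⟨{ hom := fun k l => if hkl : k = 0 ∧ l = -1 then
                eqToHom (by rw [hkl.1]) ≫ h ≫ eqToHom (by rw [hkl.2]; rfl) else 0
              zero := ?_
              comm := ?_ }⟩
    · intro k l hkl
      rw [dif_neg]
      rintro ⟨rfl, rfl⟩
      exact hkl (by simp)
    · intro k
      by_cases hk : k = -1
      · subst hk
        rw [dNext_eq _ (show (ComplexShape.up ℤ).Rel (-1) 0 by simp),
          prevD_eq _ (show (ComplexShape.up ℤ).Rel (-2) (-1) by simp), dif_pos ⟨rfl, rfl⟩,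
          dif_neg (by simp), zero_comp, hh]
        erw [eqToHom_refl, eqToHom_refl, Category.comp_id, Category.id_comp, add_zero,
          add_zero]
        rfl
      · by_cases hk0 : k = 0
        · subst hk0
          exact (hZ _ (by decide) (by decide)).eq_of_tgt _ _
        · exact (hX k hk hk0).eq_of_src _ _
  · have hg0 : g = 0 := by
      ext k
      by_cases hk : k = -1 ∨ k = 0
      swap
      · exact (hX k (fun h => hk (.inl h)) (fun h => hk (.inr h))).eq_of_src _ _
      -- The only place where both terms can be nonzero. There X¹ = 0 turns compatibility with the
      -- differentials, up to the sign of the shifted one, into the hypothesis of `hinj`.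
      by_cases hik : k = 0 ∧ i = -1
      · obtain ⟨rfl, rfl⟩ := hik
        refine hinj (g.f 0) ?_
        have hc (φ : X.X 0 ⟶ Y.X (-1)) (ψ : X.X 1 ⟶ Y.X 0)
            (hφ : φ ≫ ((-1 : ℤ).negOnePow • Y.d (-1) 0) = X.d 0 1 ≫ ψ) :
            φ ≫ Y.d (-1) 0 = 0 := by
          rwa [(hX 1 (by decide) (by decide)).eq_of_src ψ 0, comp_zero,
            Int.negOnePow_neg, Int.negOnePow_one, Units.neg_smul, one_smul,
            Preadditive.comp_neg, neg_eq_zero] at hφ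
        exact hc _ (g.f 1) (g.comm 0 1)
      · exact (hZ k (by omega) (by omega)).eq_of_tgt _ _
    rw [hg0, Functor.map_zero]

end HomVanishing

lemma hom_shift_biproduct_eq_zero {D : Type*} [Category D] [Preadditive D] [HasShift D ℤ]
    [∀ n : ℤ, (shiftFunctor D n).Additive] [HasFiniteBiproducts D] {J : Type} [Fintype J]
    (Z : J → D) (n : ℤ) (h : ∀ j k (f : Z j ⟶ (Z k)⟦n⟧), f = 0)
    (f : (⨁ Z) ⟶ (⨁ Z)⟦n⟧) : f = 0 := by
  classical
  refine biproduct.hom_ext' _ _ fun j => ?_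
  rw [comp_zero, ← Category.comp_id (biproduct.ι Z j ≫ f), ← CategoryTheory.Functor.map_id, ← biproduct.total,
    Functor.map_sum, Preadditive.comp_sum]
  refine Finset.sum_eq_zero fun k _ => ?_
  rw [Functor.map_comp, ← Category.assoc, h j k (_ ≫ _), zero_comp]

end Homotopy

end Tilting

namespace Tilting

section ModuleRetract

variable {R : Type u} [Ring R]

lemma projective_of_retract {M N : ModuleCat.{u} R} (r : Retract M N)
    (h : Module.Projective R N) : Module.Projective R M :=
  Module.Projective.of_split r.i.hom r.r.hom (by
    rw [← ModuleCat.hom_comp, r.retract]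
    rfl)

lemma finite_of_retract {M N : ModuleCat.{u} R} (r : Retract M N)
    (h : Module.Finite R N) : Module.Finite R M :=
  Module.Finite.of_surjective r.r.hom fun x => ⟨r.i.hom x, by
    rw [← LinearMap.comp_apply, ← ModuleCat.hom_comp, r.retract]
    rfl⟩

end ModuleRetract

/-! ### Building perfect complexes from their terms -/

section Devissage

variable {A : Type u} [Ring A]

variable {X : CochainComplex (ModuleCat.{u} Aᵐᵒᵖ) ℤ} {a : ℤ}

/-- The projection of a complex onto its lowest term. -/
noncomputable def toLowest (h : ∀ k, k < a → IsZero (X.X k)) :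
    X ⟶ (CochainComplex.singleFunctor (ModuleCat.{u} Aᵐᵒᵖ) a).obj (X.X a) :=
  HomologicalComplex.mkHomToSingle (𝟙 _) fun k hk =>
    (h k (by have : k + 1 = a := hk; omega)).eq_of_src _ _

lemma isIso_toLowest_f (h : ∀ k, k < a → IsZero (X.X k)) : IsIso ((toLowest h).f a) := by
  have hf : (toLowest h).f a =
      (HomologicalComplex.singleObjXSelf (ComplexShape.up ℤ) a (X.X a)).symm.hom :=
    (HomologicalComplex.mkHomToSingle_f (K := X) _ _).trans (Category.id_comp _)
  rw [hf]
  exact Iso.isIso_hom _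

lemma isZero_single_X (M : ModuleCat.{u} Aᵐᵒᵖ) {k : ℤ} (hk : k ≠ a) :
    IsZero (((CochainComplex.singleFunctor (ModuleCat.{u} Aᵐᵒᵖ) a).obj M).X k) :=
  HomologicalComplex.isZero_single_obj_X (ComplexShape.up ℤ) a M k hk

lemma epi_toLowest (h : ∀ k, k < a → IsZero (X.X k)) : Epi (toLowest h) := by
  refine HomologicalComplex.epi_of_epi_f _ fun k => ?_
  by_cases hk : k = a
  · subst hk
    have := isIso_toLowest_f h
    infer_instance
  · exact (isZero_single_X _ hk).epi _

lemma projective_single_X (M : ModuleCat.{u} Aᵐᵒᵖ) [Projective M] (k : ℤ) :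
    Projective (((CochainComplex.singleFunctor (ModuleCat.{u} Aᵐᵒᵖ) a).obj M).X k) := by
  by_cases hk : k = a
  · subst hk
    exact Projective.of_iso (HomologicalComplex.singleObjXSelf (ComplexShape.up ℤ) k M).symm
      inferInstance
  · exact Projective.of_iso (isZero_single_X M hk).isoZero.symm inferInstance

/-- The short exact sequence which splits off the lowest term of a complex. -/
noncomputable def lowestShortComplex (h : ∀ k, k < a → IsZero (X.X k)) :
    ShortComplex (CochainComplex (ModuleCat.{u} Aᵐᵒᵖ) ℤ) :=
  ShortComplex.mk (kernel.ι (toLowest h)) (toLowest h) (kernel.condition _)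

lemma lowestShortComplex_shortExact (h : ∀ k, k < a → IsZero (X.X k)) :
    (lowestShortComplex h).ShortExact where
  exact := ShortComplex.exact_of_f_is_kernel _ (kernelIsKernel _)
  mono_f := by dsimp [lowestShortComplex]; infer_instance
  epi_g := epi_toLowest h

/-- The splittings of `lowestShortComplex`. -/
noncomputable def lowestSplitting (h : ∀ k, k < a → IsZero (X.X k)) [Projective (X.X a)] (k : ℤ) :
    ((lowestShortComplex h).map (HomologicalComplex.eval _ _ k)).Splitting :=
  have : Projective ((lowestShortComplex h).map (HomologicalComplex.eval _ _ k)).X₃ :=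
    projective_single_X (X.X a) k
  ((lowestShortComplex_shortExact h).map_of_exact
    (HomologicalComplex.eval _ _ k)).splittingOfProjective

/-- The terms of the kernel are retracts of those of the complex. -/
noncomputable def lowestRetract (h : ∀ k, k < a → IsZero (X.X k)) [Projective (X.X a)] (k : ℤ) :
    Retract ((kernel (toLowest h)).X k) (X.X k) where
  i := (kernel.ι (toLowest h)).f k
  r := (lowestSplitting h k).r
  retract := (lowestSplitting h k).f_r

lemma isZero_kernel_toLowest (h : ∀ k, k < a → IsZero (X.X k)) [Projective (X.X a)] :
    IsZero ((kernel (toLowest h)).X a) := by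
  have := isIso_toLowest_f h
  have hz : (kernel.ι (toLowest h)).f a = 0 := by
    rw [← cancel_mono ((toLowest h).f a), ← HomologicalComplex.comp_f, kernel.condition,
      zero_comp, HomologicalComplex.zero_f]
  rw [IsZero.iff_id_eq_zero, ← (lowestRetract h a).retract]
  exact (congrArg (· ≫ _) hz).trans zero_comp

variable (Q : ObjectProperty (HoMod A)) [Q.IsTriangulated] [Q.IsClosedUnderIsomorphisms]

lemma quotient_mem_of_isZero (h : ∀ k, IsZero (X.X k)) : Q ((HomotopyCategory.quotient _ _).obj X) := by
  have hX : IsZero X := by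
    rw [IsZero.iff_id_eq_zero]
    ext k : 1
    exact (h k).eq_of_src _ _
  exact Q.prop_of_isZero ((HomotopyCategory.quotient _ _).map_isZero hX)

/-- Induction on the number n of degrees allowed to be nonzero. The kernel of the projection onto
the lowest term occupies the degrees above a, and its terms are retracts of those of X because the
sequence splits degreewise by projectivity. -/
lemma quotient_mem_of_single_mem
    (hQ : ∀ M : ModuleCat.{u} Aᵐᵒᵖ, Module.Finite Aᵐᵒᵖ M → Module.Projective Aᵐᵒᵖ M →
      Q ((HomotopyCategory.quotient _ _).obj ((CochainComplex.singleFunctor _ 0).obj M))) (n : ℕ) :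
    ∀ (X : CochainComplex (ModuleCat.{u} Aᵐᵒᵖ) ℤ) (a : ℤ),
      (∀ k, k < a ∨ a + n ≤ k → IsZero (X.X k)) → (∀ k, Module.Finite Aᵐᵒᵖ (X.X k)) →
      (∀ k, Module.Projective Aᵐᵒᵖ (X.X k)) → Q ((HomotopyCategory.quotient _ _).obj X) := by
  induction n with
  | zero => exact fun X a h _ _ => quotient_mem_of_isZero Q fun k => h k (by omega)
  | succ n ih =>
    intro X a h hfin hproj
    have hl (k) (hk : k < a) : IsZero (X.X k) := h k (.inl hk)
    have := hproj a
    have : Projective (X.X a) := inferInstance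
    refine quotient_mem₂_of_degreewiseSplit Q _ (lowestSplitting hl)
      (ih (kernel (toLowest hl)) (a + 1) (fun k hk => ?_)
        (fun k => finite_of_retract (lowestRetract hl k) (hfin k))
        (fun k => projective_of_retract (lowestRetract hl k) (hproj k)))
      (single_mem_of_single_mem Q _ 0 a (hQ _ (hfin a) (hproj a)))
    by_cases hka : k = a
    · subst hka
      exact isZero_kernel_toLowest hl
    · have hz : IsZero (X.X k) := h k (by push_cast; omega)
      rw [IsZero.iff_id_eq_zero, ← (lowestRetract hl k).retract,
        hz.eq_of_src (lowestRetract hl k).r 0, comp_zero]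

/-- A triangulated subcategory which contains the stalk complexes of the finitely generated
projective modules contains all perfect complexes. -/
theorem kbProj_le
    (hQ : ∀ M : ModuleCat.{u} Aᵐᵒᵖ, Module.Finite Aᵐᵒᵖ M → Module.Projective Aᵐᵒᵖ M →
      Q ((HomotopyCategory.quotient _ _).obj ((CochainComplex.singleFunctor _ 0).obj M))) : kbProj A ≤ Q := by
  rintro Y ⟨X, ⟨⟨a, b, hab⟩, hfin, hproj⟩, ⟨φ⟩⟩
  exact Q.prop_of_iso φ.symm (quotient_mem_of_single_mem Q hQ (b + 1 - a).toNat X a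
    (fun k hk => hab k (by omega)) hfin hproj)

end Devissage

/-! ### Finite direct sums in the homotopy category -/

section Biproducts

lemma prop_biproduct {D : Type*} [Category D] [Preadditive D] [HasZeroObject D] [HasShift D ℤ]
    [∀ n : ℤ, (shiftFunctor D n).Additive] [Pretriangulated D] [HasFiniteBiproducts D]
    (Q : ObjectProperty D) [Q.IsTriangulated] [Q.IsClosedUnderIsomorphisms] {J : Type} [Finite J]
    (Z : J → D) (h : ∀ j, Q (Z j)) : Q (⨁ Z) :=
  Q.prop_of_iso (biproduct.isoProduct Z).symm (Q.prop_pi Z h)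

variable {A : Type u} [Ring A]

lemma addOf_of_retract {T Y : HoMod A} (r : Retract Y T) : addOf A T Y :=
  ⟨1, ⟨r.trans (Retract.ofIso (biproductUniqueIso fun _ : Fin 1 => T).symm)⟩⟩

lemma addOf_biproduct {J : Type} [Finite J] (Z : J → HoMod A) (j : J) :
    addOf A (⨁ Z) (Z j) :=
  addOf_of_retract ⟨biproduct.ι Z j, biproduct.π Z j, biproduct.ι_π_self Z j⟩

/-- A finite direct sum of perfect complexes with the same bounds is perfect. -/
lemma kbProj_biproduct {J : Type} [Finite J]
    (Z : J → CochainComplex (ModuleCat.{u} Aᵐᵒᵖ) ℤ) (a b : ℤ)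
    (hz : ∀ j n, n < a ∨ b < n → IsZero ((Z j).X n))
    (hfin : ∀ j n, Module.Finite Aᵐᵒᵖ ((Z j).X n))
    (hproj : ∀ j n, Module.Projective Aᵐᵒᵖ ((Z j).X n)) :
    kbProj A (⨁ fun j => (HomotopyCategory.quotient _ _).obj (Z j)) := by
  classical
  cases nonempty_fintype J
  have : HasFiniteBiproducts (CochainComplex (ModuleCat.{u} Aᵐᵒᵖ) ℤ) :=
    Abelian.hasFiniteBiproducts
  have φ (n : ℤ) : (⨁ Z).X n ≅ ModuleCat.of Aᵐᵒᵖ (∀ j, (Z j).X n) :=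
    (HomologicalComplex.eval _ _ n).mapBiproduct Z ≪≫ ModuleCat.biproductIsoPi _
  refine ⟨⨁ Z, ⟨⟨a, b, fun n hn => ?_⟩, fun n => ?_, fun n => ?_⟩,
    ⟨((HomotopyCategory.quotient _ _).mapBiproduct Z).symm⟩⟩
  · refine IsZero.of_iso ?_ (φ n)
    have hs (j) : Subsingleton ((Z j).X n) := ModuleCat.subsingleton_of_isZero (hz j n hn)
    exact ModuleCat.isZero_iff_subsingleton.2 inferInstance
  · have := fun j => hfin j n
    exact Module.Finite.equiv (φ n).symm.toLinearEquiv
  · have := fun j => hproj j n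
    have : Module.Projective Aᵐᵒᵖ (∀ j, (Z j).X n) :=
      Module.Projective.of_equiv (DirectSum.linearEquivFunOnFintype Aᵐᵒᵖ J fun j => (Z j).X n)
    exact Module.Projective.of_equiv (φ n).symm.toLinearEquiv

end Biproducts

end Tilting

namespace HigherSpherical

/-! ### Homomorphisms P_i → P_j as elements of e_jSe_i -/

section HomP

variable {K : Type u} [Field K] {m : ℕ} {lam : K} {i j : Vertex}

/-- Since eᵢ generates Pᵢ, a homomorphism is left multiplication by its value at eᵢ. Both conditions
on morphisms thus become statements about products in S. -/
lemma incl_hom_apply (g : P K m lam i ⟶ P K m lam j) (y : P K m lam i) :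
    incl K m lam j (g.hom y) =
      incl K m lam j (g.hom (eP K m lam i)) * incl K m lam i y := by
  conv_lhs => rw [← op_smul_eP y, map_smul, incl_smul, MulOpposite.unop_op]

lemma incl_hom_eP_mul_e (g : P K m lam i ⟶ P K m lam j) :
    incl K m lam j (g.hom (eP K m lam i)) * e K m lam i =
      incl K m lam j (g.hom (eP K m lam i)) :=
  (incl_hom_apply g (eP K m lam i)).symm

lemma homP_ext {g h : P K m lam i ⟶ P K m lam j}
    (H : incl K m lam j (g.hom (eP K m lam i)) = incl K m lam j (h.hom (eP K m lam i))) :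
    g = h := by
  ext y
  apply incl_injective
  exact (incl_hom_apply g y).trans ((congrArg (· * _) H).trans (incl_hom_apply h y).symm)

lemma incl_arrowHom_apply (a : Arrow) (x : P K m lam a.tgt) :
    incl K m lam a.src ((arrowHom K m lam a).hom x) =
      arrow K m lam a * incl K m lam a.tgt x := rfl

variable (K m lam i) in
/-- Left multiplication by an element of `eⱼS` as a homomorphism `Pᵢ → Pⱼ`. -/
noncomputable def mulHom (y : S K m lam) (hy : e K m lam j * y = y) :
    P K m lam i ⟶ P K m lam j :=
  ModuleCat.ofHom ((leftMul K m lam y).restrict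
    (p := idealP K m lam i) (q := idealP K m lam j)
    fun x _ => mem_idealP.2 (by
      change e K m lam j * (y * x) = y * x
      rw [← mul_assoc, hy]))

lemma incl_mulHom_apply (y : S K m lam) (hy : e K m lam j * y = y) (x : P K m lam i) :
    incl K m lam j ((mulHom K m lam i y hy).hom x) = y * incl K m lam i x := rfl

lemma exists_eq_arrowHom_comp {a : Arrow}
    (ha : ∀ x : S K m lam, ∃ y,
      e K m lam j * x * e K m lam a.tgt = e K m lam j * y * arrow K m lam a)
    (g : P K m lam a.tgt ⟶ P K m lam j) : ∃ h, g = arrowHom K m lam a ≫ h := by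
  obtain ⟨y, hy⟩ := ha (incl K m lam j (g.hom (eP K m lam a.tgt)))
  rw [e_mul_incl, incl_hom_eP_mul_e] at hy
  have hj : e K m lam j * (e K m lam j * y) = e K m lam j * y := by
    rw [← mul_assoc, e_mul_e, if_pos rfl]
  refine ⟨mulHom K m lam a.src (e K m lam j * y) hj, homP_ext ?_⟩
  rw [hy, ModuleCat.hom_comp, LinearMap.comp_apply, incl_mulHom_apply, incl_arrowHom_apply]
  change _ = _ * (_ * e K m lam a.tgt)
  rw [arrow_mul_e_tgt]

lemma eq_zero_of_comp_arrowHom {a : Arrow}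
    (ha : ∀ x : S K m lam, e K m lam a.tgt * x = x → x * e K m lam i = x →
      arrow K m lam a * x = 0 → x = 0)
    (g : P K m lam i ⟶ P K m lam a.tgt) (hg : g ≫ arrowHom K m lam a = 0) : g = 0 := by
  refine homP_ext ((ha _ (e_mul_incl _) (incl_hom_eP_mul_e g) ?_).trans (map_zero _).symm)
  have h : (arrowHom K m lam a).hom (g.hom (eP K m lam i)) = 0 :=
    congrArg (fun f => f.hom (eP K m lam i)) hg
  rw [← incl_arrowHom_apply, h, map_zero]

end HomP

/-! ### The stalk and two-term summands -/

section Summands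

variable {K : Type u} [Field K] {m : ℕ} {lam : K}

/-- Morphisms from `Pᵢ` to the term of degree `-1` of `Y` are detected by the differential. -/
def DetectedByDifferential (i : Vertex) (Y : CochainComplex (ModuleCat.{u} (S K m lam)ᵐᵒᵖ) ℤ) :
    Prop :=
  ∀ g : P K m lam i ⟶ Y.X (-1), g ≫ Y.d (-1) 0 = 0 → g = 0

/-- Morphisms from the term of degree `-1` of `X` to `Pⱼ` factor through the differential. -/
def FactorsThroughDifferential (X : CochainComplex (ModuleCat.{u} (S K m lam)ᵐᵒᵖ) ℤ)
    (j : Vertex) : Prop :=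
  ∀ g : X.X (-1) ⟶ P K m lam j, ∃ h : X.X 0 ⟶ P K m lam j, g = X.d (-1) 0 ≫ h

/-- A complex concentrated in the degrees `-1` and `0` with finitely generated projective terms
whose term of degree `0` is `Pᵢ`. -/
structure IsTwoTerm (X : CochainComplex (ModuleCat.{u} (S K m lam)ᵐᵒᵖ) ℤ) (i : Vertex) :
    Prop where
  isZero : ∀ k, k ≠ -1 → k ≠ 0 → IsZero (X.X k)
  finite : ∀ k, Module.Finite (S K m lam)ᵐᵒᵖ (X.X k)
  projective : ∀ k, Module.Projective (S K m lam)ᵐᵒᵖ (X.X k)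
  iso : Nonempty (X.X 0 ≅ P K m lam i)

lemma finite_of_iso {M : ModuleCat.{u} (S K m lam)ᵐᵒᵖ} {i : Vertex} (φ : M ≅ P K m lam i) :
    Module.Finite (S K m lam)ᵐᵒᵖ M :=
  Tilting.finite_of_retract (Retract.ofIso φ) inferInstance

lemma projective_of_iso {M : ModuleCat.{u} (S K m lam)ᵐᵒᵖ} {i : Vertex} (φ : M ≅ P K m lam i) :
    Module.Projective (S K m lam)ᵐᵒᵖ M :=
  Tilting.projective_of_retract (Retract.ofIso φ) inferInstance

lemma finite_of_isZero {M : ModuleCat.{u} (S K m lam)ᵐᵒᵖ} (h : IsZero M) :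
    Module.Finite (S K m lam)ᵐᵒᵖ M := by
  have := ModuleCat.subsingleton_of_isZero h
  infer_instance

lemma projective_of_isZero {M : ModuleCat.{u} (S K m lam)ᵐᵒᵖ} (h : IsZero M) :
    Module.Projective (S K m lam)ᵐᵒᵖ M := by
  have := ModuleCat.subsingleton_of_isZero h
  infer_instance

lemma stalk_isZero {i : Vertex} {k : ℤ} (h : k ≠ 0) : IsZero ((stalk K m lam i).X k) :=
  HomologicalComplex.isZero_single_obj_X (ComplexShape.up ℤ) 0 (P K m lam i) k h

variable (K m lam) in
/-- The term of degree `0` of a stalk complex. -/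
noncomputable def stalkIso (i : Vertex) : (stalk K m lam i).X 0 ≅ P K m lam i :=
  HomologicalComplex.singleObjXSelf (ComplexShape.up ℤ) 0 (P K m lam i)

lemma isTwoTerm_stalk (i : Vertex) : IsTwoTerm (stalk K m lam i) i where
  isZero _ _ h := stalk_isZero h
  finite k := by
    by_cases h : k = 0
    · subst h
      exact finite_of_iso (stalkIso K m lam i)
    · exact finite_of_isZero (stalk_isZero h)
  projective k := by
    by_cases h : k = 0
    · subst h
      exact projective_of_iso (stalkIso K m lam i)
    · exact projective_of_isZero (stalk_isZero h)
  iso := ⟨stalkIso K m lam i⟩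

lemma detectedByDifferential_stalk (i j : Vertex) :
    DetectedByDifferential i (stalk K m lam j) :=
  fun _ _ => (stalk_isZero (by decide)).eq_of_tgt _ _

lemma factorsThroughDifferential_stalk (i j : Vertex) :
    FactorsThroughDifferential (stalk K m lam i) j :=
  fun _ => ⟨0, (stalk_isZero (by decide)).eq_of_src _ _⟩

variable (K m lam) in
/-- The term of degree `-1` of a two-term complex. -/
noncomputable def twoTermIso₀ (a : Arrow) : (twoTerm K m lam a).X (-1) ≅ P K m lam a.tgt :=
  HomologicalComplex.doubleXIso₀ _ _

variable (K m lam) in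
/-- The term of degree `0` of a two-term complex. -/
noncomputable def twoTermIso₁ (a : Arrow) : (twoTerm K m lam a).X 0 ≅ P K m lam a.src :=
  HomologicalComplex.doubleXIso₁ _ _ (by decide)

lemma twoTerm_d (a : Arrow) : (twoTerm K m lam a).d (-1) 0 =
    (twoTermIso₀ K m lam a).hom ≫ arrowHom K m lam a ≫ (twoTermIso₁ K m lam a).inv :=
  HomologicalComplex.double_d _ _ (by decide)

lemma twoTerm_isZero {a : Arrow} {k : ℤ} (h : k ≠ -1) (h' : k ≠ 0) :
    IsZero ((twoTerm K m lam a).X k) :=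
  HomologicalComplex.isZero_double_X _ _ k h h'

lemma isTwoTerm_twoTerm (a : Arrow) : IsTwoTerm (twoTerm K m lam a) a.src where
  isZero _ h h' := twoTerm_isZero h h'
  finite k := by
    by_cases h : k = 0
    · subst h
      exact finite_of_iso (twoTermIso₁ K m lam a)
    · by_cases h' : k = -1
      · subst h'
        exact finite_of_iso (twoTermIso₀ K m lam a)
      · exact finite_of_isZero (twoTerm_isZero h' h)
  projective k := by
    by_cases h : k = 0
    · subst h
      exact projective_of_iso (twoTermIso₁ K m lam a)
    · by_cases h' : k = -1
      · subst h'
        exact projective_of_iso (twoTermIso₀ K m lam a)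
      · exact projective_of_isZero (twoTerm_isZero h' h)
  iso := ⟨twoTermIso₁ K m lam a⟩

lemma detectedByDifferential_twoTerm {a : Arrow} {i : Vertex}
    (ha : ∀ x : S K m lam, e K m lam a.tgt * x = x → x * e K m lam i = x →
      arrow K m lam a * x = 0 → x = 0) :
    DetectedByDifferential i (twoTerm K m lam a) := by
  intro g hg
  rw [twoTerm_d, ← Category.assoc, ← Category.assoc,
    ← cancel_mono (twoTermIso₁ K m lam a).hom, Category.assoc, Iso.inv_hom_id,
    Category.comp_id, zero_comp] at hg
  rw [← cancel_mono (twoTermIso₀ K m lam a).hom, zero_comp]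
  exact eq_zero_of_comp_arrowHom ha _ hg

lemma factorsThroughDifferential_twoTerm {a : Arrow} {j : Vertex}
    (ha : ∀ x : S K m lam, ∃ y,
      e K m lam j * x * e K m lam a.tgt = e K m lam j * y * arrow K m lam a) :
    FactorsThroughDifferential (twoTerm K m lam a) j := by
  intro g
  obtain ⟨h, hh⟩ := exists_eq_arrowHom_comp ha ((twoTermIso₀ K m lam a).inv ≫ g)
  refine ⟨(twoTermIso₁ K m lam a).hom ≫ h, ?_⟩
  rw [twoTerm_d, Category.assoc, Category.assoc, Iso.inv_hom_id_assoc, ← hh,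
    Iso.hom_inv_id_assoc]

lemma IsTwoTerm.hom_shift_eq_zero {X Y : CochainComplex (ModuleCat.{u} (S K m lam)ᵐᵒᵖ) ℤ}
    {i j : Vertex} (hX : IsTwoTerm X i) (hY : IsTwoTerm Y j) (hinj : DetectedByDifferential i Y)
    (hfac : FactorsThroughDifferential X j) (n : ℤ) (hn : n ≠ 0)
    (f : (HomotopyCategory.quotient _ _).obj X ⟶ ((HomotopyCategory.quotient _ _).obj Y)⟦n⟧) :
    f = 0 := by
  obtain ⟨φ⟩ := hX.iso
  obtain ⟨ψ⟩ := hY.iso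
  refine Tilting.hom_shift_eq_zero_of_twoTerm hX.isZero hY.isZero (fun g hg => ?_)
    (fun g => ?_) n hn f
  · rw [← cancel_epi φ.inv, comp_zero]
    exact hinj _ (by rw [Category.assoc, hg, comp_zero])
  · obtain ⟨h, hh⟩ := hfac (g ≫ ψ.hom)
    exact ⟨h ≫ ψ.inv, by rw [← Category.assoc, ← hh, Category.assoc, Iso.hom_inv_id,
      Category.comp_id]⟩

end Summands

/-! ### The two tilting complexes -/

section Tilting

variable {K : Type u} [Field K] {m : ℕ} {lam : K}

lemma kbProj_le_of_stalk_mem (hm : 2 ≤ m) (Q : ObjectProperty (Tilting.HoMod (S K m lam)))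
    [Q.IsTriangulated] [Q.IsClosedUnderIsomorphisms]
    (h : ∀ i, Q ((HomotopyCategory.quotient _ _).obj (stalk K m lam i))) :
    Tilting.kbProj (S K m lam) ≤ Q := by
  refine Tilting.kbProj_le Q fun M _ _ => ?_
  obtain ⟨n, i, ⟨φ⟩⟩ := exists_equiv_pi_P (K := K) (lam := lam) (X := M) hm
  let F := CochainComplex.singleFunctor (ModuleCat.{u} (S K m lam)ᵐᵒᵖ) 0 ⋙
    HomotopyCategory.quotient _ (ComplexShape.up ℤ)
  have ψ : F.obj M ≅ ⨁ fun k => F.obj (P K m lam (i k)) :=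
    F.mapIso (φ.toModuleIso ≪≫ (ModuleCat.biproductIsoPi fun k => P K m lam (i k)).symm) ≪≫
      F.mapBiproduct fun k => P K m lam (i k)
  exact Q.prop_of_iso ψ.symm (Tilting.prop_biproduct Q _ fun k => h (i k))

lemma isTiltingComplex_of_isTwoTerm (hm : 2 ≤ m)
    (Z : Vertex → CochainComplex (ModuleCat.{u} (S K m lam)ᵐᵒᵖ) ℤ) (b : Vertex → Vertex)
    (hZ : ∀ i, IsTwoTerm (Z i) (b i)) (hinj : ∀ i j, DetectedByDifferential (b i) (Z j))
    (hfac : ∀ i j, FactorsThroughDifferential (Z i) (b j))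
    (hgen : ∀ Q : ObjectProperty (Tilting.HoMod (S K m lam)), Q.IsTriangulated →
      Q.IsClosedUnderIsomorphisms → (∀ i, Q ((HomotopyCategory.quotient _ _).obj (Z i))) →
      ∀ i, Q ((HomotopyCategory.quotient _ _).obj (stalk K m lam i))) :
    Tilting.IsTiltingComplex (S K m lam)
      (⨁ fun i => (HomotopyCategory.quotient _ _).obj (Z i)) where
  mem := Tilting.kbProj_biproduct Z (-1) 0
    (fun i n hn => (hZ i).isZero n (by omega) (by omega))
    (fun i => (hZ i).finite) (fun i => (hZ i).projective)
  hom_shift_eq_zero n hn := Tilting.hom_shift_biproduct_eq_zero _ n fun i j =>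
    (hZ i).hom_shift_eq_zero (hZ j) (hinj i j) (hfac i j) n hn
  generates Q hQ hQ' h := kbProj_le_of_stalk_mem hm Q (hgen Q hQ hQ' fun i =>
    h _ (Tilting.addOf_biproduct _ i))

lemma stalk_tgt_mem (Q : ObjectProperty (Tilting.HoMod (S K m lam))) [Q.IsTriangulated]
    [Q.IsClosedUnderIsomorphisms] (a : Arrow)
    (h : Q ((HomotopyCategory.quotient _ _).obj (stalk K m lam a.src)))
    (h' : Q ((HomotopyCategory.quotient _ _).obj (twoTerm K m lam a))) :
    Q ((HomotopyCategory.quotient _ _).obj (stalk K m lam a.tgt)) :=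
  Tilting.single_mem_of_double_mem Q (arrowHom K m lam a) _ h h'

lemma detectedByDifferential_ν (hm : 2 ≤ m) (hlam : lam ≠ 0) {i : Vertex} (hi : i ≠ .v5) :
    DetectedByDifferential i (twoTerm K m lam .ν) := by
  obtain ⟨n, rfl⟩ := Nat.exists_eq_add_of_le' hm
  exact detectedByDifferential_twoTerm fun x hx hx' h => eq_zero_of_nu_mul hlam hi hx hx' h

lemma detectedByDifferential_γ (hm : 2 ≤ m) (hlam : lam ≠ 0) {i : Vertex} (h4 : i ≠ .v4)
    (h5 : i ≠ .v5) : DetectedByDifferential i (twoTerm K m lam .γ) := by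
  obtain ⟨n, rfl⟩ := Nat.exists_eq_add_of_le' hm
  exact detectedByDifferential_twoTerm fun x hx hx' h => eq_zero_of_gamma_mul hlam h4 h5 hx hx' h

theorem isTiltingComplex_T₁ (hm : 2 ≤ m) (hlam : lam ≠ 0) :
    Tilting.IsTiltingComplex (S K m lam) (T₁ K m lam) := by
  -- The vertex of the degree 0 term of each summand. It is never 5, which is what injectivity of ν
  -- and factorization through ν ask for.
  let b : Vertex → Vertex := fun i => if i = .v5 then .v3 else i
  have hb (i) : b i ≠ .v5 := by cases i <;> decide
  refine isTiltingComplex_of_isTwoTerm hm (summand₁ K m lam) b (fun i => ?_) (fun i j => ?_)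
    (fun i j => ?_) fun Q _ _ h => ?_
  · cases i
    case v5 => exact isTwoTerm_twoTerm .ν
    all_goals exact isTwoTerm_stalk _
  · cases j
    case v5 => exact detectedByDifferential_ν hm hlam (hb i)
    all_goals exact detectedByDifferential_stalk _ _
  · cases i
    case v5 => exact factorsThroughDifferential_twoTerm fun x => exists_e_mul_e5 (hb j) x
    all_goals exact factorsThroughDifferential_stalk _ _
  · rintro (_ | _ | _ | _ | _ | _)
    case v5 => exact stalk_tgt_mem Q .ν (h .v3) (h .v5)
    exacts [h .v1, h .v2, h .v3, h .v4, h .v6]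

theorem isTiltingComplex_T₂ (hm : 2 ≤ m) (hlam : lam ≠ 0) :
    Tilting.IsTiltingComplex (S K m lam) (T₂ K m lam) := by
  -- Both modified summands have P₃ in degree 0, so 4 and 5 are avoided, as injectivity of γ
  -- demands.
  let b : Vertex → Vertex := fun i => if i = .v4 ∨ i = .v5 then .v3 else i
  have h4 (i) : b i ≠ .v4 := by cases i <;> decide
  have h5 (i) : b i ≠ .v5 := by cases i <;> decide
  refine isTiltingComplex_of_isTwoTerm hm (summand₂ K m lam) b (fun i => ?_) (fun i j => ?_)
    (fun i j => ?_) fun Q _ _ h => ?_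
  · cases i
    case v4 => exact isTwoTerm_twoTerm .γ
    case v5 => exact isTwoTerm_twoTerm .ν
    all_goals exact isTwoTerm_stalk _
  · cases j
    case v4 => exact detectedByDifferential_γ hm hlam (h4 i) (h5 i)
    case v5 => exact detectedByDifferential_ν hm hlam (h5 i)
    all_goals exact detectedByDifferential_stalk _ _
  · cases i
    case v4 => exact factorsThroughDifferential_twoTerm fun x => exists_e_mul_e4 (h4 j) x
    case v5 => exact factorsThroughDifferential_twoTerm fun x => exists_e_mul_e5 (h5 j) x
    all_goals exact factorsThroughDifferential_stalk _ _
  · rintro (_ | _ | _ | _ | _ | _)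
    case v4 => exact stalk_tgt_mem Q .γ (h .v3) (h .v4)
    case v5 => exact stalk_tgt_mem Q .ν (h .v3) (h .v5)
    exacts [h .v1, h .v2, h .v3, h .v6]

end Tilting

end HigherSpherical

theorem proposition4p2 (K : Type u) [Field K] [IsAlgClosed K] (m : ℕ) (hm : 2 ≤ m)
    (lam : K) (hlam : lam ≠ 0) :
    Tilting.IsTiltingComplex (HigherSpherical.S K m lam) (HigherSpherical.T₁ K m lam) ∧
      Tilting.IsTiltingComplex (HigherSpherical.S K m lam) (HigherSpherical.T₂ K m lam) :=
  ⟨HigherSpherical.isTiltingComplex_T₁ hm hlam, HigherSpherical.isTiltingComplex_T₂ hm hlam⟩
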